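/- **Setting (the topos of trees).** Let $\mathcal S$ be the category of presheaves of sets over $\omega$: an object $A$ is a sequence of sets $A(n)$ with restriction maps $A(n+1)\to A(n)$. Let $\triangleright A$ be given by $(\triangleright A)(1)=\{\ast\}$, $(\triangleright A)(n+1)=A(n)$, with $\mathsf{next}:A\to\triangleright A$ and later application $\circledast:\triangleright(A\to B)\times\triangleright A\to\triangleright B$. The lifting monad $LA$ is the unique solution of $LA=A+\triangleright LA$, with structure maps $\eta:A\to LA$ and $\theta:\triangleright LA\to LA$, and $\delta=\theta\circ\mathsf{next}$. The set $\forall\kappa.A$ is the set of global elements of $A$. A type (proof-relevant relation) over an object $B$ is a presheaf of sets over the category of elements of $B$; identity types are equality at each stage, $\Sigma$, $\Pi$, $\to$, $\triangleright$ on such types are interpreted in the standard way, and for a global element $b$ of $B$ the set $\forall\kappa.R(b[\kappa])$ is the set of global elements of $R$ over $b$; "$\forall\kappa.R(b[\kappa])$ holds" means that this set is inhabited. **The language FPC.** Types are $\tau::=\alpha\mid 1\mid\tau+\tau\mid\tau\times\tau\mid\tau\to\tau\mid\mu\alpha.\tau$. Terms are $M::=\langle\rangle\mid x\mid\mathsf{inl}\,M\mid\mathsf{inr}\,M\mid\mathsf{case}\,L\text{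 of }x_1.M;x_2.N\mid\langle M,N\rangle\mid\mathsf{fst}\,M\mid\mathsf{snd}\,M\mid\lambda x{:}\sigma.M\mid MN\mid\mathsf{fold}\,M\mid\mathsf{unfold}\,M$, with the usual typing judgement $\Gamma\vdash M:\tau$ over contexts of closed types; in particular $\mathsf{fold}\,M:\mu\alpha.\tau$ if $M:\tau[\mu\alpha.\tau/\alpha]$, and conversely for $\mathsf{unfold}$. Values are $\langle\rangle$, $\mathsf{inl}\,M$, $\mathsf{inr}\,M$, $\langle M,N\rangle$, $\lambda x{:}\sigma.M$, $\mathsf{fold}\,M$. The call-by-name big-step semantics $M\Downarrow^k v$ is generated by: $v\Downarrow^0v$ for values $v$; if $L\Downarrow^k\mathsf{inl}\,L'$ and $M[L'/x_1]\Downarrow^mv$ then $\mathsf{case}\,L\text{ of }x_1.M;x_2.N\Downarrow^{m+k}v$, and symmetrically for $\mathsf{inr}$; if $L\Downarrow^k\langle M,N\rangle$ and $M\Downarrow^lv$ then $\mathsf{fst}\,L\Downarrow^{k+l}v$, and symmetrically for $\mathsf{snd}$; if $M\Downarrow^k\lambda x{:}\sigma.L$ and $L[N/x]\Downarrow^lv$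 then $MN\Downarrow^{k+l}v$; if $M\Downarrow^k\mathsf{fold}\,N$ and $N\Downarrow^mv$ then $\mathsf{unfold}\,M\Downarrow^{k+m+1}v$. Write $M\Downarrow v$ if $M\Downarrow^kv$ for some $k$. **Denotational semantics.** Types are interpreted in $\mathcal S$ by $[\![1]\!]=L1$, $[\![\sigma+\tau]\!]=L([\![\sigma]\!]+[\![\tau]\!])$, $[\![\sigma\times\tau]\!]=[\![\sigma]\!]\times[\![\tau]\!]$, $[\![\sigma\to\tau]\!]=[\![\sigma]\!]\to[\![\tau]\!]$, and $[\![\mu\alpha.\tau]\!]$ is the guarded fixed point of $X\mapsto\triangleright[\![\tau]\!](X)$, so that $[\![\mu\alpha.\tau]\!]=\triangleright[\![\tau[\mu\alpha.\tau/\alpha]]\!]$. The maps $\theta_\tau:\triangleright[\![\tau]\!]\to[\![\tau]\!]$ are defined, for all closed $\tau$ simultaneously by guarded recursion and by induction on $\tau$, as the structure map of $L$ for $\tau=1$ and $\tau=\tau_1+\tau_2$, by $\theta_{\sigma\times\tau}(x)=\langle\theta_\sigma(\triangleright(\pi_1)(x)),\theta_\tau(\triangleright(\pi_2)(x))\rangle$,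 by $\theta_{\sigma\to\tau}(f)=\lambda x.\theta_\tau(f\circledast\mathsf{next}\,x)$, and by $\theta_{\mu\alpha.\tau}(x)=\mathsf{next}(\theta_{\tau[\mu\alpha.\tau/\alpha]})\circledast x$. For $\Gamma=x_1{:}\sigma_1,\dots,x_n{:}\sigma_n$ let $[\![\Gamma]\!]=[\![\sigma_1]\!]\times\dots\times[\![\sigma_n]\!]$. A derivation of $\Gamma\vdash M:\tau$ is interpreted as a morphism $[\![M]\!]:[\![\Gamma]\!]\to[\![\tau]\!]$: variables are projections, abstraction, application, pairing and projections are those of $\mathcal S$, $[\![\langle\rangle]\!](\gamma)=\eta(\ast)$, $[\![\mathsf{inl}\,M]\!](\gamma)=\eta(\mathrm{inl}([\![M]\!](\gamma)))$, $[\![\mathsf{inr}\,M]\!](\gamma)=\eta(\mathrm{inr}([\![M]\!](\gamma)))$, $[\![\mathsf{fold}\,M]\!](\gamma)=\mathsf{next}([\![M]\!](\gamma))$, $[\![\mathsf{unfold}\,M]\!](\gamma)=\theta_{\tau[\mu\alpha.\tau/\alpha]}([\![M]\!](\gamma))$, and $[\![\mathsf{case}\,L\text{ of }x_1.M;x_2.N]\!](\gamma)=\hat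 f([\![L]\!](\gamma))$, where $\hat f:L([\![\tau_1]\!]+[\![\tau_2]\!])\to[\![\sigma]\!]$ is the unique extension of $f=[[\![M]\!](\gamma,-),[\![N]\!](\gamma,-)]$ with $\hat f\circ\eta=f$ and $\hat f(\theta(r))=\theta_\sigma(\mathsf{next}(\hat f)\circledast r)$. The global denotation $[\![M]\!]^{\mathrm{gl}}=\Lambda\kappa.[\![M]\!]$ is the resulting element of $\forall\kappa.([\![\Gamma]\!]\to[\![\tau]\!])$. **Weak bisimulation.** For a type-valued relation $R$ between $A$ and $B$, the relation $LR$ between $LA$ and $LB$ is defined by guarded recursion: $\eta(a)\,LR\,\eta(b)$ is $a\,R\,b$; $\eta(a)\,LR\,\theta(y)$ is $\Sigma m{:}\mathbb N,b'{:}B.\ (\theta(y)=\delta^m(\eta(b')))\times a\,R\,b'$; $\theta(x)\,LR\,\eta(b)$ is $\Sigma m{:}\mathbb N,a'{:}A.\ (\theta(x)=\delta^m(\eta(a')))\times a'\,R\,b$; $\theta(x)\,LR\,\theta(y)$ is $x\,(\triangleright LR)\,y$. The relations $\approx_\tau$ on $[\![\tau]\!]$ are defined by guarded recursion and induction on $\tau$: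 $x\approx_1y$ is $x\,L(=_1)\,y$; $x\approx_{\sigma+\tau}y$ is $x\,L(\approx_\sigma+\approx_\tau)\,y$, where $R+S$ relates $\mathrm{inl}\,a,\mathrm{inl}\,a'$ when $a\,R\,a'$, relates $\mathrm{inr}\,b,\mathrm{inr}\,b'$ when $b\,S\,b'$, and is empty otherwise; $x\approx_{\sigma\times\tau}y$ is $(\pi_1x\approx_\sigma\pi_1y)\times(\pi_2x\approx_\tau\pi_2y)$; $f\approx_{\sigma\to\tau}g$ is $\Pi x,y.\ x\approx_\sigma y\to f(x)\approx_\tau g(y)$; $x\approx_{\mu\alpha.\tau}y$ is $x\,(\triangleright\approx_{\tau[\mu\alpha.\tau/\alpha]})\,y$. For $f,g:[\![\Gamma]\!]\to[\![\tau]\!]$, let $f\approx_{\Gamma,\tau}g$ be $\Pi\vec x,\vec y.\ \vec x\approx_{\vec\sigma}\vec y\to f(\vec x)\approx_\tau g(\vec y)$. For $u,v:\forall\kappa.([\![\Gamma]\!]\to[\![\tau]\!])$ let $u\approx^{\mathrm{gl}}_{\Gamma,\tau}v$ be $\forall\kappa.\,u[\kappa]\approx_{\Gamma,\tau}v[\kappa]$.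 **Contextual equivalence.** A context $C$ is a term with one hole, which may stand in any position of a term, including under binders; $C[M]$ is the result of filling the hole, possibly capturing variables, and $C:(\Gamma,\tau)\to(\Delta,\sigma)$ is the usual typing of contexts. For $\Gamma\vdash M,N:\tau$, $M$ and $N$ are contextually equivalent, $M\approx_{\mathrm{CTX}}N$, if for all contexts $C:(\Gamma,\tau)\to(-,1)$, $C[M]\Downarrow\langle\rangle$ if and only if $C[N]\Downarrow\langle\rangle$. **Theorem (Extensional Computational Adequacy).** If $\Gamma\vdash M,N:\tau$ and $[\![M]\!]^{\mathrm{gl}}\approx^{\mathrm{gl}}_{\Gamma,\tau}[\![N]\!]^{\mathrm{gl}}$, then $M\approx_{\mathrm{CTX}}N$. -/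

import Mathlib

namespace FPC

/-! ## The topos of trees: presheaves of sets over the ordinal `ω` -/

/-- An object of the topos of trees. Stage `n` here is the set `X(n+1)` in the numbering of stages
that starts with one. -/
structure Tree : Type 1 where
  obj : ℕ → Type
  res : ∀ n, obj (n + 1) → obj n

namespace Tree

/-- Morphisms of the topos of trees: natural transformations. -/
@[ext] structure Hom (A B : Tree) where
  app : ∀ n, A.obj n → B.obj n
  nat : ∀ n a, B.res n (app (n + 1) a) = app n (A.res n a)

/-- The set of global elements of `A`; this models `∀ κ. A` for the single clock `κ`. -/
def Global (A : Tree) : Type := {x : ∀ n, A.obj n // ∀ n, A.res n (x (n + 1)) = x n}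

/-- Restriction along `i ≤ n`. -/
def resLE (A : Tree) {i n : ℕ} (h : i ≤ n) (a : A.obj n) : A.obj i :=
  Nat.decreasingInduction (motive := fun m _ => A.obj m) (fun k _ x => A.res k x) a h

theorem resLE_self (A : Tree) {n : ℕ} (a : A.obj n) : A.resLE le_rfl a = a :=
  Nat.decreasingInduction_self _ _

theorem res_resLE (A : Tree) {i n : ℕ} (h : i + 1 ≤ n) (a : A.obj n) :
    A.res i (A.resLE h a) = A.resLE (Nat.le_of_succ_le h) a :=
  (Nat.decreasingInduction_succ_left (motive := fun m _ => A.obj m) (fun k _ x => A.res k x) a h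
    (Nat.le_of_succ_le h)).symm

theorem resLE_res (A : Tree) {i n : ℕ} (h : i ≤ n) (a : A.obj (n + 1)) :
    A.resLE h (A.res n a) = A.resLE (Nat.le_succ_of_le h) a :=
  (Nat.decreasingInduction_succ (motive := fun m _ => A.obj m) (fun k _ x => A.res k x) a h
    (Nat.le_succ_of_le h)).symm

/-! ### Type formers -/

/-- The terminal object. -/
abbrev one : Tree where
  obj _ := PUnit
  res _ _ := PUnit.unit

/-- Binary products. -/
abbrev prod (A B : Tree) : Tree where
  obj n := A.obj n × B.obj n
  res n p := (A.res n p.1, B.res n p.2)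

/-- Binary coproducts. -/
abbrev sum (A B : Tree) : Tree where
  obj n := A.obj n ⊕ B.obj n
  res n := Sum.map (A.res n) (B.res n)

/-- Exponentials: at stage `n`, natural families of maps over the stages `i ≤ n`. -/
abbrev exp (A B : Tree) : Tree where
  obj n := {f : ∀ i, i ≤ n → A.obj i → B.obj i //
    ∀ i (h : i + 1 ≤ n) a, B.res i (f (i + 1) h a) = f i (Nat.le_of_succ_le h) (A.res i a)}
  res _ f := ⟨fun i h => f.1 i (Nat.le_succ_of_le h), fun i h => f.2 i (Nat.le_succ_of_le h)⟩

/-- Products over a constant index type. -/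
abbrev pi (I : Type) (A : I → Tree) : Tree where
  obj n := ∀ i, (A i).obj n
  res n x i := (A i).res n (x i)

/-- The type former `▷`. -/
abbrev later (A : Tree) : Tree where
  obj n := match n with
    | 0 => PUnit
    | k + 1 => A.obj k
  res n := match n with
    | 0 => fun _ => PUnit.unit
    | k + 1 => A.res k

/-- The carriers of `▷ (L A)`, where `(L A)(n) = A(n) + (▷ L A)(n)`. -/
def liftTailObj (A : Tree) : ℕ → Type
  | 0 => PUnit
  | n + 1 => A.obj n ⊕ liftTailObj A n

/-- The restriction maps of `▷ (L A)`. -/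
def liftTailRes (A : Tree) : ∀ n, liftTailObj A (n + 1) → liftTailObj A n
  | 0 => fun _ => PUnit.unit
  | n + 1 => Sum.map (A.res n) (liftTailRes A n)

/-- The guarded lifting monad, the unique solution of `L A = A + ▷ (L A)`. -/
abbrev lift (A : Tree) : Tree where
  obj n := A.obj n ⊕ liftTailObj A n
  res n := Sum.map (A.res n) (liftTailRes A n)

/-! ### Terms of the internal language -/

def idHom (A : Tree) : Hom A A := ⟨fun _ a => a, fun _ _ => rfl⟩

def comp {A B C : Tree} (g : Hom B C) (f : Hom A B) : Hom A C :=
  ⟨fun n a => g.app n (f.app n a), fun n a => by rw [g.nat, f.nat]⟩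

/-- The identity morphism between equal objects. -/
def homOfEq {A B : Tree} (h : A = B) : Hom A B :=
  ⟨fun n => cast (congrArg (fun X : Tree => X.obj n) h), by subst h; intro n a; rfl⟩

def toOne (A : Tree) : Hom A one := ⟨fun _ _ => PUnit.unit, fun _ _ => rfl⟩

def fstHom (A B : Tree) : Hom (prod A B) A := ⟨fun _ p => p.1, fun _ _ => rfl⟩

def sndHom (A B : Tree) : Hom (prod A B) B := ⟨fun _ p => p.2, fun _ _ => rfl⟩

def pairHom {C A B : Tree} (f : Hom C A) (g : Hom C B) : Hom C (prod A B) :=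
  ⟨fun n c => (f.app n c, g.app n c), fun n c => by simp only [prod, f.nat, g.nat]⟩

def inlHom (A B : Tree) : Hom A (sum A B) := ⟨fun _ a => Sum.inl a, fun _ _ => rfl⟩

def inrHom (A B : Tree) : Hom B (sum A B) := ⟨fun _ b => Sum.inr b, fun _ _ => rfl⟩

/-- Case analysis in a context `C`. -/
def caseHom {C A B X : Tree} (f : Hom (prod C A) X) (g : Hom (prod C B) X) :
    Hom (prod C (sum A B)) X :=
  ⟨fun n p => Sum.elim (fun a => f.app n (p.1, a)) (fun b => g.app n (p.1, b)) p.2, by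
    rintro n ⟨c, a | b⟩
    · exact f.nat n (c, a)
    · exact g.nat n (c, b)⟩

def curry {C A B : Tree} (f : Hom (prod C A) B) : Hom C (exp A B) :=
  ⟨fun n c => ⟨fun i h a => f.app i (C.resLE h c, a), fun i h a =>
      (f.nat i _).trans (congrArg (fun z => f.app i (z, A.res i a)) (C.res_resLE h c))⟩,
    fun n c => Subtype.ext (by
      funext i h a
      exact congrArg (fun z => f.app i (z, a)) (C.resLE_res h c).symm)⟩

def evalHom (A B : Tree) : Hom (prod (exp A B) A) B :=
  ⟨fun n p => p.1.1 n le_rfl p.2, fun n p => p.1.2 n le_rfl p.2⟩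

def proj {I : Type} (A : I → Tree) (i : I) : Hom (pi I A) (A i) :=
  ⟨fun _ x => x i, fun _ _ => rfl⟩

def tuple {I : Type} {C : Tree} {A : I → Tree} (f : ∀ i, Hom C (A i)) : Hom C (pi I A) :=
  ⟨fun n c i => (f i).app n c, fun n c => funext fun i => (f i).nat n c⟩

/-- `next : A → ▷ A`. -/
def next (A : Tree) : Hom A (later A) where
  app n := match n with
    | 0 => fun _ => PUnit.unit
    | k + 1 => A.res k
  nat n := match n with
    | 0 => fun _ => rfl
    | _ + 1 => fun _ => rfl

/-- The functorial action of `▷`, that is `x ↦ next f ⊛ x`. -/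
def laterMap {A B : Tree} (f : Hom A B) : Hom (later A) (later B) where
  app n := match n with
    | 0 => fun _ => PUnit.unit
    | k + 1 => f.app k
  nat n := match n with
    | 0 => fun _ => rfl
    | k + 1 => f.nat k

/-- The applicative structure of `▷`, in the form `▷ A × ▷ B → ▷ (A × B)`. -/
def laterPair (A B : Tree) : Hom (prod (later A) (later B)) (later (prod A B)) where
  app n := match n with
    | 0 => fun _ => PUnit.unit
    | _ + 1 => fun p => p
  nat n := match n with
    | 0 => fun _ => rfl
    | _ + 1 => fun _ => rfl

/-- Later application `⊛ : ▷ (A → B) × ▷ A → ▷ B`. -/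
def laterApp (A B : Tree) : Hom (prod (later (exp A B)) (later A)) (later B) :=
  comp (laterMap (evalHom A B)) (laterPair (exp A B) A)

/-- The components of `fixElt`. -/
def fixFun {A : Tree} (f : Hom (later A) A) : ∀ n, A.obj n
  | 0 => f.app 0 PUnit.unit
  | n + 1 => f.app (n + 1) (fixFun f n)

/-- The guarded fixed point operator `fix : (▷ A → A) → A`. -/
def fixElt {A : Tree} (f : Hom (later A) A) : Global A :=
  ⟨fixFun f, fun n => by
    induction n with
    | zero => exact f.nat 0 _
    | succ n ih => exact (f.nat (n + 1) _).trans (congrArg (f.app (n + 1)) ih)⟩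

/-- A global element as a constant morphism. -/
def Global.toHom {A : Tree} (x : Global A) (C : Tree) : Hom C A :=
  ⟨fun n _ => x.1 n, fun n _ => x.2 n⟩

/-! ### The `▷`-algebra structure of the lifting monad -/

/-- `η : A → L A`. -/
def now (A : Tree) : Hom A (lift A) := ⟨fun _ a => Sum.inl a, fun _ _ => rfl⟩

/-- `θ : ▷ (L A) → L A`. -/
def tickLift (A : Tree) : Hom (later (lift A)) (lift A) where
  app n := match n with
    | 0 => fun x => Sum.inr x
    | _ + 1 => fun x => Sum.inr x
  nat n := match n with
    | 0 => fun _ => rfl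
    | _ + 1 => fun _ => rfl

/-- `δ = θ ∘ next : L A → L A`. -/
def delayLift (A : Tree) : Hom (lift A) (lift A) := comp (tickLift A) (next (lift A))

/-- The components of `extend`. -/
def extendApp {C A B : Tree} (θ : Hom (later B) B) (f : Hom (prod C A) B) :
    ∀ n, C.obj n → (lift A).obj n → B.obj n
  | n, c, Sum.inl a => f.app n (c, a)
  | 0, _, Sum.inr _ => θ.app 0 PUnit.unit
  | n + 1, c, Sum.inr r => θ.app (n + 1) (extendApp θ f n (C.res n c) r)

/-- The extension of `f : A → B` to a homomorphism of `▷`-algebras `L A → B`, where `B` carries the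
algebra structure `θ`, in a context `C`:
`f̂ (η a) = f a` and `f̂ (θ r) = θ (next f̂ ⊛ r)`. -/
def extend {C A B : Tree} (θ : Hom (later B) B) (f : Hom (prod C A) B) :
    Hom (prod C (lift A)) B :=
  ⟨fun n p => extendApp θ f n p.1 p.2, by
    intro n
    induction n with
    | zero =>
      rintro ⟨c, a | r⟩
      · exact f.nat 0 (c, a)
      · exact θ.nat 0 _
    | succ n ih =>
      rintro ⟨c, a | r⟩
      · exact f.nat (n + 1) (c, a)
      · exact (θ.nat (n + 1) _).trans (congrArg (θ.app (n + 1)) (ih (C.res (n + 1) c, r)))⟩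

end Tree

/-! ## Dependent types and proof-relevant relations -/

/-- A type in context `B`: a presheaf over the category of elements of `B`. -/
structure Fam (B : Tree) : Type 1 where
  obj : ∀ n, B.obj n → Type
  res : ∀ n b b', B.res n b = b' → obj (n + 1) b → obj n b'

/-- Proof-relevant relations `A × A' → U`. -/
abbrev Rel (A A' : Tree) : Type 1 := Fam (Tree.prod A A')

namespace Fam

/-- The type `∀ κ. R (x[κ])` for a global element `x` of `B`. -/
def Global {B : Tree} (R : Fam B) (x : Tree.Global B) : Type :=
  {e : ∀ n, R.obj n (x.1 n) // ∀ n, R.res n _ _ (x.2 n) (e (n + 1)) = e n}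

/-- Reindexing. -/
def reindex {A B : Tree} (f : Tree.Hom A B) (R : Fam B) : Fam A where
  obj n a := R.obj n (f.app n a)
  res n a a' h e := R.res n _ _ (by rw [f.nat, h]) e

/-- The identity type of `A`. -/
def eqRel (A : Tree) : Rel A A where
  obj _ p := PLift (p.1 = p.2)
  res _ _ _ h e := ⟨by subst h; exact congrArg _ e.down⟩

/-- Conjunction of relations on the components of a product. -/
def prodRel {A A' B B' : Tree} (R : Rel A A') (S : Rel B B') :
    Rel (Tree.prod A B) (Tree.prod A' B') where
  obj n p := R.obj n (p.1.1, p.2.1) × S.obj n (p.1.2, p.2.2)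
  res n p p' h e := (R.res n _ _ (by subst h; rfl) e.1, S.res n _ _ (by subst h; rfl) e.2)

/-- The carriers of `R + S`, at a fixed stage. -/
def sumRelObj {X X' Y Y' : Type} (R : X × X' → Type) (S : Y × Y' → Type) :
    X ⊕ Y → X' ⊕ Y' → Type
  | Sum.inl a, Sum.inl a' => R (a, a')
  | Sum.inr b, Sum.inr b' => S (b, b')
  | Sum.inl _, Sum.inr _ => Empty
  | Sum.inr _, Sum.inl _ => Empty

/-- The restriction maps of `R + S`, at a fixed stage. -/
def sumRelRes {A A' B B' : Tree} {n : ℕ}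
    {R : (Tree.prod A A').obj n → Type} {R₁ : (Tree.prod A A').obj (n + 1) → Type}
    {S : (Tree.prod B B').obj n → Type} {S₁ : (Tree.prod B B').obj (n + 1) → Type}
    (f : ∀ p, R₁ p → R ((Tree.prod A A').res n p)) (g : ∀ p, S₁ p → S ((Tree.prod B B').res n p)) :
    ∀ (x : (Tree.sum A B).obj (n + 1)) (y : (Tree.sum A' B').obj (n + 1)),
      sumRelObj R₁ S₁ x y → sumRelObj R S ((Tree.sum A B).res n x) ((Tree.sum A' B').res n y)
  | Sum.inl a, Sum.inl a' => f (a, a')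
  | Sum.inr b, Sum.inr b' => g (b, b')
  | Sum.inl _, Sum.inr _ => fun e => nomatch e
  | Sum.inr _, Sum.inl _ => fun e => nomatch e

/-- The relation `R + S` on coproducts: `inl x (R + S) inl y` is `x R y`, `inr x (R + S) inr y` is
`x S y`, and the other cases are empty. -/
def sumRel {A A' B B' : Tree} (R : Rel A A') (S : Rel B B') :
    Rel (Tree.sum A B) (Tree.sum A' B') where
  obj n p := sumRelObj (R.obj n) (S.obj n) p.1 p.2
  res n p p' h := match p', h with
    | _, rfl => sumRelRes (fun q => R.res n q _ rfl) (fun q => S.res n q _ rfl) p.1 p.2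

/-- The relation on function spaces: `f` and `g` are related when
`Π x y. x R y → f(x) S g(y)`. -/
def expRel {A A' B B' : Tree} (R : Rel A A') (S : Rel B B') :
    Rel (Tree.exp A B) (Tree.exp A' B') where
  obj n p := {φ : ∀ i (h : i ≤ n) (q : A.obj i × A'.obj i),
      R.obj i q → S.obj i (p.1.1 i h q.1, p.2.1 i h q.2) //
    ∀ i (h : i + 1 ≤ n) (q : A.obj (i + 1) × A'.obj (i + 1)) (e : R.obj (i + 1) q),
      S.res i _ _ (Prod.mk.injEq .. ▸ ⟨p.1.2 i h q.1, p.2.2 i h q.2⟩) (φ (i + 1) h q e) =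
        φ i (Nat.le_of_succ_le h) (A.res i q.1, A'.res i q.2) (R.res i q _ rfl e)}
  res _ _ p' h := match p', h with
    | _, rfl => fun φ => ⟨fun i hi => φ.1 i (Nat.le_succ_of_le hi),
        fun i hi => φ.2 i (Nat.le_succ_of_le hi)⟩

/-- The lifting of a relation from `A, A'` to `▷ A, ▷ A'`. -/
def laterRel {A A' : Tree} (R : Rel A A') : Rel (Tree.later A) (Tree.later A') where
  obj n := match n with
    | 0 => fun _ => PUnit
    | k + 1 => fun p => R.obj k p
  res n := match n with
    | 0 => fun _ _ _ _ => PUnit.unit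
    | k + 1 => fun p p' h e => R.res k p p' h e

theorem delay_res {B : Tree} (n m : ℕ) (x : (Tree.lift B).obj (n + 1)) :
    (Tree.lift B).res n (((Tree.delayLift B).app (n + 1))^[m] x) =
      ((Tree.delayLift B).app n)^[m] ((Tree.lift B).res n x) := by
  induction m generalizing x with
  | zero => rfl
  | succ m ih => rw [Function.iterate_succ_apply, Function.iterate_succ_apply, ih,
      (Tree.delayLift B).nat]

/-- The type `Σ m, b'. t = δᵐ(η(b')) and Q(b')` at stage `n`. -/
def Ends {B : Tree} (n : ℕ) (Q : B.obj n → Type) (t : (Tree.lift B).obj n) : Type :=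
  Σ (m : ℕ) (b' : B.obj n), PLift (t = ((Tree.delayLift B).app n)^[m] ((Tree.now B).app n b')) × Q b'

/-- The restriction maps of `Ends`. -/
def Ends.res {B : Tree} {n : ℕ} {Q₁ : B.obj (n + 1) → Type} {Q : B.obj n → Type}
    (f : ∀ b, Q₁ b → Q (B.res n b)) {t : (Tree.lift B).obj (n + 1)} (e : Ends (n + 1) Q₁ t) :
    Ends n Q ((Tree.lift B).res n t) :=
  ⟨e.1, B.res n e.2.1, ⟨(congrArg _ e.2.2.1.down).trans (delay_res n e.1 _)⟩, f _ e.2.2.2⟩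

/-- The defining clauses of `L R` at stage `n`, where `Q` is `R` at stage `n` and `T` is `▷ (L R)` at
stage `n`; here `Sum.inl a` is `η a` and `Sum.inr x` is `θ x`. -/
def liftRelStep {A B : Tree} (n : ℕ) (Q : (Tree.prod A B).obj n → Type)
    (T : A.liftTailObj n → B.liftTailObj n → Type) :
    (Tree.lift A).obj n → (Tree.lift B).obj n → Type
  | Sum.inl a, Sum.inl b => Q (a, b)
  | Sum.inl a, Sum.inr y => Ends n (fun b => Q (a, b)) (Sum.inr y : (Tree.lift B).obj n)
  | Sum.inr x, Sum.inl b => Ends n (fun a => Q (a, b)) (Sum.inr x : (Tree.lift A).obj n)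
  | Sum.inr x, Sum.inr y => T x y

/-- The carriers of `▷ (L R)`. -/
def liftRelTail {A B : Tree} (R : Rel A B) :
    ∀ n, A.liftTailObj n → B.liftTailObj n → Type
  | 0 => fun _ _ => PUnit
  | n + 1 => liftRelStep n (R.obj n) (liftRelTail R n)

/-- The restriction maps of `L R`, given those of `R` and of `▷ (L R)`. -/
def liftRelStepRes {A B : Tree} {n : ℕ}
    {Q₁ : (Tree.prod A B).obj (n + 1) → Type} {Q : (Tree.prod A B).obj n → Type}
    {T₁ : A.liftTailObj (n + 1) → B.liftTailObj (n + 1) → Type}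
    {T : A.liftTailObj n → B.liftTailObj n → Type}
    (f : ∀ p, Q₁ p → Q ((Tree.prod A B).res n p))
    (g : ∀ x y, T₁ x y → T (A.liftTailRes n x) (B.liftTailRes n y)) :
    ∀ (x : (Tree.lift A).obj (n + 1)) (y : (Tree.lift B).obj (n + 1)),
      liftRelStep (n + 1) Q₁ T₁ x y →
        liftRelStep n Q T ((Tree.lift A).res n x) ((Tree.lift B).res n y)
  | Sum.inl a, Sum.inl b => f (a, b)
  | Sum.inl a, Sum.inr _ => Ends.res (fun b => f (a, b))
  | Sum.inr _, Sum.inl b => Ends.res (fun a => f (a, b))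
  | Sum.inr x, Sum.inr y => g x y

/-- The restriction maps of `▷ (L R)`. -/
def liftRelTailRes {A B : Tree} (R : Rel A B) :
    ∀ n x y, liftRelTail R (n + 1) x y →
      liftRelTail R n (A.liftTailRes n x) (B.liftTailRes n y)
  | 0 => fun _ _ _ => PUnit.unit
  | n + 1 => liftRelStepRes (fun p => R.res n p _ rfl) (liftRelTailRes R n)

/-- The relation `L R` on `L A × L B`, defined by guarded recursion and case analysis:
* `η a (L R) η b` is `a R b`;
* `η a (L R) θ y` is `Σ m, b'. θ y = δᵐ (η b')` and `a R b'`;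
* `θ x (L R) η b` is `Σ m, a'. θ x = δᵐ (η a')` and `a' R b`;
* `θ x (L R) θ y` is `x (▷ L R) y`. -/
def liftRel {A B : Tree} (R : Rel A B) : Rel (Tree.lift A) (Tree.lift B) where
  obj n p := liftRelStep n (R.obj n) (liftRelTail R n) p.1 p.2
  res n p p' h := match p', h with
    | _, rfl => liftRelStepRes (fun q => R.res n q _ rfl) (liftRelTailRes R n) p.1 p.2

end Fam

end FPC

namespace FPC

/-! ## Guarded recursive types: existence and uniqueness of fixed points -/

/-- The part of a presheaf below stage `n`. -/
structure FamT (B : Tree) (n : ℕ) : Type 1 where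
  obj : ∀ k, k < n → B.obj k → Type
  res : ∀ k (h : k + 1 < n) b b', B.res k b = b' → obj (k + 1) h b → obj k (Nat.lt_of_succ_lt h) b'

namespace Fam

def trunc {B : Tree} (n : ℕ) (F : Fam B) : FamT B n := ⟨fun k _ => F.obj k, fun k _ => F.res k⟩

theorem trunc_eq_iff {B : Tree} {n : ℕ} {F G : Fam B} : F.trunc n = G.trunc n ↔
    ∃ h : ∀ k, k < n → ∀ b, F.obj k b = G.obj k b,
      ∀ k (hk : k + 1 < n) b b' e x, cast (h k (Nat.lt_of_succ_lt hk) b') (F.res k b b' e x) =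
        G.res k b b' e (cast (h (k + 1) hk b) x) := by
  have key : ∀ {S T : FamT B n}, S = T ↔
    ∃ h : ∀ k (hk : k < n) b, S.obj k hk b = T.obj k hk b,
      ∀ k (hk : k + 1 < n) b b' e x, cast (h k (Nat.lt_of_succ_lt hk) b') (S.res k hk b b' e x) =
        T.res k hk b b' e (cast (h (k + 1) hk b) x) := by
    intro S T
    constructor
    · rintro rfl
      exact ⟨fun _ _ _ => rfl, fun _ _ _ _ _ _ => rfl⟩
    · rintro ⟨h, h'⟩
      obtain ⟨so, sr⟩ := S
      obtain ⟨uo, ur⟩ := T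
      obtain rfl : so = uo := by
        funext k hk b
        exact h k hk b
      congr 1
      funext k hk b b' e x
      exact h' k hk b b' e x
  exact key

theorem trunc_mono {B : Tree} {m n : ℕ} (hmn : m ≤ n) {F G : Fam B} (h : F.trunc n = G.trunc n) :
    F.trunc m = G.trunc m := by
  rw [trunc_eq_iff] at h ⊢
  obtain ⟨h, h'⟩ := h
  exact ⟨fun k hk => h k (hk.trans_le hmn), fun k hk => h' k (hk.trans_le hmn)⟩

theorem trunc_zero {B : Tree} (F G : Fam B) : F.trunc 0 = G.trunc 0 :=
  trunc_eq_iff.2 ⟨fun _ h => absurd h (Nat.not_lt_zero _), fun _ h => absurd h (Nat.not_lt_zero _)⟩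

theorem eq_of_trunc {B : Tree} {F G : Fam B} (h : ∀ n, F.trunc n = G.trunc n) : F = G := by
  obtain ⟨fo, fr⟩ := F
  obtain ⟨go, gr⟩ := G
  obtain rfl : fo = go := by
    funext k b
    obtain ⟨h1, -⟩ := trunc_eq_iff.1 (h (k + 1))
    exact h1 k (Nat.lt_succ_self k) b
  congr 1
  funext k b b' e x
  obtain ⟨_, h2⟩ := trunc_eq_iff.1 (h (k + 2))
  exact h2 k (Nat.lt_succ_self _) b b' e x

theorem glue {B : Tree} (X : ℕ → Fam B) (h : ∀ k, (X k).trunc k = (X (k + 1)).trunc k) :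
    ∃ Y : Fam B, ∀ k, Y.trunc k = (X k).trunc k := by
  have mono : ∀ k m, k ≤ m → (X k).trunc k = (X m).trunc k := by
    intro k m hkm
    induction m, hkm using Nat.le_induction with
    | base => rfl
    | succ m hm ih => exact ih.trans (trunc_mono hm (h m))
  have hob : ∀ k m, k < m → ∀ b, (X (k + 1)).obj k b = (X m).obj k b := fun k m hk b =>
    (trunc_eq_iff.1 (mono (k + 1) m hk)).1 k (Nat.lt_succ_self k) b
  refine ⟨⟨fun k b => (X (k + 1)).obj k b, fun k b b' e x =>
    cast (hob k (k + 2) (by omega) b').symm ((X (k + 2)).res k b b' e x)⟩, fun n => ?_⟩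
  rw [trunc_eq_iff]
  refine ⟨fun k hk b => hob k n hk b, fun k hk b b' e x => ?_⟩
  obtain ⟨_, h2⟩ := trunc_eq_iff.1 (mono (k + 2) n hk)
  rw [← h2 k (Nat.lt_succ_self _) b b' e x, cast_cast]

/-- A map on families of presheaves is contractive when its output up to stage `n` only depends on
its input up to stage `n - 1`, that is, when it factors through `▷`. -/
def Contractive {I : Type} {B : I → Tree} (Φ : (∀ i, Fam (B i)) → ∀ i, Fam (B i)) : Prop :=
  ∀ n X Y, (∀ i, (X i).trunc n = (Y i).trunc n) → ∀ i, (Φ X i).trunc (n + 1) = (Φ Y i).trunc (n + 1)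

theorem existsUnique_fix {I : Type} {B : I → Tree} (Φ : (∀ i, Fam (B i)) → ∀ i, Fam (B i))
    (hΦ : Contractive Φ) : ∃! X, Φ X = X := by
  let X : ℕ → ∀ i, Fam (B i) := fun k =>
    Φ^[k] (fun i => ⟨fun _ _ => PUnit, fun _ _ _ _ _ => PUnit.unit⟩)
  have hX : ∀ k, X (k + 1) = Φ (X k) := fun k => Function.iterate_succ_apply' _ _ _
  have h : ∀ k i, (X k i).trunc k = (X (k + 1) i).trunc k := by
    intro k
    induction k with
    | zero => exact fun i => trunc_zero _ _
    | succ k ih =>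
      intro i
      rw [hX (k + 1), hX k]
      exact hΦ k _ _ (by rwa [hX k] at ih) i
  choose Y hY using fun i => glue (fun k => X k i) (fun k => h k i)
  refine ⟨Y, ?_, ?_⟩
  · funext i
    refine eq_of_trunc fun n => ?_
    cases n with
    | zero => exact trunc_zero _ _
    | succ n =>
      rw [hY i (n + 1), hX n]
      exact hΦ n _ _ (fun j => hY j n) i
  · intro Z hZ
    have key : ∀ n i, (Z i).trunc n = (Y i).trunc n := by
      intro n
      induction n with
      | zero => exact fun i => trunc_zero _ _
      | succ n ih =>
        intro i
        rw [hY i (n + 1), hX n]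
        conv_lhs => rw [← hZ]
        exact hΦ n _ _ (fun j => (ih j).trans (hY j n)) i
    funext i
    exact eq_of_trunc fun n => key n i

end Fam

namespace Tree

/-- A closed type as a type in the empty context. -/
def toFam (A : Tree) : Fam one := ⟨fun n _ => A.obj n, fun n _ _ _ => A.res n⟩

def ofFam (F : Fam one) : Tree :=
  ⟨fun n => F.obj n PUnit.unit, fun n => F.res n PUnit.unit PUnit.unit rfl⟩

/-- `A` and `B` coincide below stage `n`. -/
def Agree (n : ℕ) (A B : Tree) : Prop := A.toFam.trunc n = B.toFam.trunc n

open Classical in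
/-- The guarded recursive type `fix F`: the unique solution of `X = F X`, for `F` contractive. -/
noncomputable def fix (F : Tree → Tree) : Tree :=
  if h : ∃! X, F X = X then h.choose else one

theorem fix_eq (F : Tree → Tree)
    (hF : ∀ n X Y, Agree n X Y → Agree (n + 1) (F X) (F Y)) : F (fix F) = fix F := by
  have h : ∃! X, F X = X := by
    obtain ⟨X, hX, hu⟩ := Fam.existsUnique_fix (I := Unit) (B := fun _ => one)
      (fun X _ => (F (ofFam (X ()))).toFam) (fun n X Y h _ => hF n _ _ (h ()))
    refine ⟨ofFam (X ()), congrArg (fun Z : Unit → Fam one => ofFam (Z ())) hX, fun Z hZ => ?_⟩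
    have := hu (fun _ => Z.toFam) (funext fun _ => congrArg toFam hZ)
    exact congrArg (fun W : Unit → Fam one => ofFam (W ())) this
  rw [fix, dif_pos h]
  exact h.choose_spec.1

theorem Agree.prod {n : ℕ} {A A' B B' : Tree} (hA : Agree n A A') (hB : Agree n B B') :
    Agree n (prod A B) (prod A' B') := by
  let g : FamT one n → FamT one n → FamT one n := fun a b =>
    ⟨fun k h z => a.obj k h z × b.obj k h z,
      fun k h z z' e p => (a.res k h z z' e p.1, b.res k h z z' e p.2)⟩
  exact congrArg₂ g hA hB

theorem Agree.sum {n : ℕ} {A A' B B' : Tree} (hA : Agree n A A') (hB : Agree n B B') :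
    Agree n (sum A B) (sum A' B') := by
  let g : FamT one n → FamT one n → FamT one n := fun a b =>
    ⟨fun k h z => a.obj k h z ⊕ b.obj k h z,
      fun k h z z' e => Sum.map (a.res k h z z' e) (b.res k h z z' e)⟩
  exact congrArg₂ g hA hB

theorem Agree.exp {n : ℕ} {A A' B B' : Tree} (hA : Agree n A A') (hB : Agree n B B') :
    Agree n (exp A B) (exp A' B') := by
  let g : FamT one n → FamT one n → FamT one n := fun a b =>
    ⟨fun k hk _ => {f : ∀ i (h : i ≤ k), a.obj i (h.trans_lt hk) PUnit.unit →
          b.obj i (h.trans_lt hk) PUnit.unit //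
        ∀ i (h : i + 1 ≤ k) x, b.res i (h.trans_lt hk) PUnit.unit PUnit.unit rfl (f (i + 1) h x) =
          f i (Nat.le_of_succ_le h) (a.res i (h.trans_lt hk) PUnit.unit PUnit.unit rfl x)},
      fun k hk z z' e f => ⟨fun i h => f.1 i (Nat.le_succ_of_le h),
        fun i h => f.2 i (Nat.le_succ_of_le h)⟩⟩
  exact congrArg₂ g hA hB

theorem Agree.later {n : ℕ} {A A' : Tree} (hA : Agree n A A') :
    Agree (n + 1) (later A) (later A') := by
  obtain ⟨h1, h2⟩ := Fam.trunc_eq_iff.1 hA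
  refine Fam.trunc_eq_iff.2 ⟨fun k hk b => ?_, fun k hk b b' e x => ?_⟩
  · cases k with
    | zero => rfl
    | succ k => exact h1 k (Nat.lt_of_succ_lt_succ hk) b
  · cases k with
    | zero => rfl
    | succ k => exact h2 k (Nat.lt_of_succ_lt_succ hk) b b' rfl x

theorem agree_zero (A B : Tree) : Agree 0 A B := Fam.trunc_zero _ _

theorem lift_eq (A : Tree) : lift A = sum A (later (lift A)) := by
  have h : (⟨liftTailObj A, liftTailRes A⟩ : Tree) = later (lift A) := by
    have : toFam ⟨liftTailObj A, liftTailRes A⟩ = toFam (later (lift A)) := by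
      refine Fam.eq_of_trunc fun n => Fam.trunc_eq_iff.2 ⟨fun k _ b => ?_, fun k _ b b' e x => ?_⟩
      · cases k <;> rfl
      · cases k <;> rfl
    exact congrArg ofFam this
  exact congrArg (sum A) h

theorem Agree.lift {n : ℕ} {A A' : Tree} (hA : Agree n A A') : Agree n (lift A) (lift A') := by
  have : ∀ m, m ≤ n → Agree m (Tree.lift A) (Tree.lift A') := by
    intro m
    induction m with
    | zero => exact fun _ => agree_zero _ _
    | succ m ih =>
      intro hm
      rw [lift_eq A, lift_eq A']
      exact Agree.sum (Fam.trunc_mono hm hA) (Agree.later (ih (Nat.le_of_succ_le hm)))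
  exact this n le_rfl

end Tree

/-! ## FPC types and their interpretation -/

/-- FPC types `Θ ⊢ τ` in a type context with `m` type variables (de Bruijn indices). -/
inductive Ty : ℕ → Type
  | var {m : ℕ} (i : Fin m) : Ty m
  | one {m : ℕ} : Ty m
  | sum {m : ℕ} (σ τ : Ty m) : Ty m
  | prod {m : ℕ} (σ τ : Ty m) : Ty m
  | arr {m : ℕ} (σ τ : Ty m) : Ty m
  | mu {m : ℕ} (τ : Ty (m + 1)) : Ty m

namespace Ty

def rename : {m k : ℕ} → (Fin m → Fin k) → Ty m → Ty k
  | _, _, r, var i => var (r i)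
  | _, _, _, one => one
  | _, _, r, sum σ τ => sum (rename r σ) (rename r τ)
  | _, _, r, prod σ τ => prod (rename r σ) (rename r τ)
  | _, _, r, arr σ τ => arr (rename r σ) (rename r τ)
  | _, _, r, mu τ => mu (rename (Fin.cases 0 (fun i => (r i).succ)) τ)

def subst : {m k : ℕ} → (Fin m → Ty k) → Ty m → Ty k
  | _, _, s, var i => s i
  | _, _, _, one => one
  | _, _, s, sum σ τ => sum (subst s σ) (subst s τ)
  | _, _, s, prod σ τ => prod (subst s σ) (subst s τ)
  | _, _, s, arr σ τ => arr (subst s σ) (subst s τ)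
  | _, _, s, mu τ => mu (subst (Fin.cases (var 0) (fun i => rename Fin.succ (s i))) τ)

/-- `τ[μα.τ/α]`. -/
def unfold {m : ℕ} (τ : Ty (m + 1)) : Ty m := subst (Fin.cases (mu τ) var) τ

/-- The interpretation `⟦Θ ⊢ τ⟧(ρ)`. -/
noncomputable def interp : {m : ℕ} → Ty m → (Fin m → Tree) → Tree
  | _, var i, ρ => ρ i
  | _, one, _ => Tree.lift Tree.one
  | _, sum σ τ, ρ => Tree.lift (Tree.sum (interp σ ρ) (interp τ ρ))
  | _, prod σ τ, ρ => Tree.prod (interp σ ρ) (interp τ ρ)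
  | _, arr σ τ, ρ => Tree.exp (interp σ ρ) (interp τ ρ)
  | _, mu τ, ρ => Tree.fix (fun X => Tree.later (interp τ (Fin.cases X ρ)))

theorem interp_agree {m : ℕ} (τ : Ty m) (n : ℕ) (ρ ρ' : Fin m → Tree)
    (h : ∀ i, Tree.Agree n (ρ i) (ρ' i)) : Tree.Agree n (interp τ ρ) (interp τ ρ') := by
  induction τ generalizing n with
  | var i => exact h i
  | one => rfl
  | sum σ τ ihσ ihτ => exact (Tree.Agree.sum (ihσ n _ _ h) (ihτ n _ _ h)).lift
  | prod σ τ ihσ ihτ => exact Tree.Agree.prod (ihσ n _ _ h) (ihτ n _ _ h)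
  | arr σ τ ihσ ihτ => exact Tree.Agree.exp (ihσ n _ _ h) (ihτ n _ _ h)
  | mu τ ih =>
    have hc : ∀ (ρ : Fin _ → Tree) n X Y, Tree.Agree n X Y →
        Tree.Agree (n + 1) (Tree.later (interp τ (Fin.cases X ρ)))
          (Tree.later (interp τ (Fin.cases Y ρ))) := fun ρ n X Y hXY =>
      Tree.Agree.later (ih n _ _ (fun i => by
        induction i using Fin.cases with
        | zero => exact hXY
        | succ i => rfl))
    have : ∀ k, k ≤ n → Tree.Agree k (interp (mu τ) ρ) (interp (mu τ) ρ') := by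
      intro k
      induction k with
      | zero => exact fun _ => Tree.agree_zero _ _
      | succ k ihk =>
        intro hk
        simp only [interp]
        rw [← Tree.fix_eq _ (hc ρ), ← Tree.fix_eq _ (hc ρ')]
        refine Tree.Agree.later (ih k _ _ fun i => ?_)
        induction i using Fin.cases with
        | zero => exact ihk (Nat.le_of_succ_le hk)
        | succ i => exact Fam.trunc_mono (Nat.le_of_succ_le hk) (h i)
    exact this n le_rfl

theorem interp_mu {m : ℕ} (τ : Ty (m + 1)) (ρ : Fin m → Tree) :
    interp (mu τ) ρ = Tree.later (interp τ (Fin.cases (interp (mu τ) ρ) ρ)) := by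
  have := Tree.fix_eq (fun X => Tree.later (interp τ (Fin.cases X ρ))) fun n X Y hXY =>
      Tree.Agree.later (interp_agree τ n _ _ (fun i => by
        induction i using Fin.cases with
        | zero => exact hXY
        | succ i => rfl))
  exact this.symm

theorem interp_rename {m k : ℕ} (r : Fin m → Fin k) (τ : Ty m) (ρ : Fin k → Tree) :
    interp (rename r τ) ρ = interp τ (fun i => ρ (r i)) := by
  induction τ generalizing k with
  | var i => rfl
  | one => rfl
  | sum σ τ ihσ ihτ => simp only [rename, interp, ihσ, ihτ]
  | prod σ τ ihσ ihτ => simp only [rename, interp, ihσ, ihτ]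
  | arr σ τ ihσ ihτ => simp only [rename, interp, ihσ, ihτ]
  | mu τ ih =>
    simp only [rename, interp, ih]
    congr 1
    funext X
    congr 2
    funext i
    induction i using Fin.cases <;> rfl

theorem interp_subst {m k : ℕ} (s : Fin m → Ty k) (τ : Ty m) (ρ : Fin k → Tree) :
    interp (subst s τ) ρ = interp τ (fun i => interp (s i) ρ) := by
  induction τ generalizing k with
  | var i => rfl
  | one => rfl
  | sum σ τ ihσ ihτ => simp only [subst, interp, ihσ, ihτ]
  | prod σ τ ihσ ihτ => simp only [subst, interp, ihσ, ihτ]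
  | arr σ τ ihσ ihτ => simp only [subst, interp, ihσ, ihτ]
  | mu τ ih =>
    simp only [subst, interp, ih]
    congr 1
    funext X
    congr 2
    funext i
    induction i using Fin.cases with
    | zero => rfl
    | succ i => exact interp_rename _ _ _

/-- The interpretation of a closed type. -/
noncomputable abbrev den (τ : Ty 0) : Tree := interp τ Fin.elim0

theorem den_mu (τ : Ty 1) : den (mu τ) = Tree.later (den (unfold τ)) := by
  refine (interp_mu τ _).trans (congrArg Tree.later ?_)
  rw [den, unfold, interp_subst]
  congr 1
  funext i
  induction i using Fin.cases with
  | zero => rfl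
  | succ i => exact i.elim0

/-- The identification `⟦μα.τ⟧ = ▷ ⟦τ[μα.τ/α]⟧`, from left to right. -/
noncomputable def unroll (τ : Ty 1) : Tree.Hom (den (mu τ)) (Tree.later (den (unfold τ))) :=
  Tree.homOfEq (den_mu τ)

/-- The identification `⟦μα.τ⟧ = ▷ ⟦τ[μα.τ/α]⟧`, from right to left. -/
noncomputable def roll (τ : Ty 1) : Tree.Hom (Tree.later (den (unfold τ))) (den (mu τ)) :=
  Tree.homOfEq (den_mu τ).symm

/-- Structural recursion on closed types. -/
noncomputable def recClosed {P : Ty 0 → Sort*} (hone : P one) (hsum : ∀ σ τ, P σ → P τ → P (sum σ τ))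
    (hprod : ∀ σ τ, P σ → P τ → P (prod σ τ)) (harr : ∀ σ τ, P σ → P τ → P (arr σ τ))
    (hmu : ∀ τ : Ty 1, P (mu τ)) : ∀ τ : Ty 0, P τ := by
  let motive : ∀ m, Ty m → Sort _ := fun m => match m with
    | 0 => P
    | _ + 1 => fun _ => PUnit
  exact fun τ => Ty.rec (motive := motive)
    (fun {m} => match m with | 0 => fun i => i.elim0 | _ + 1 => fun _ => PUnit.unit)
    (fun {m} => match m with | 0 => hone | _ + 1 => PUnit.unit)
    (fun {m} => match m with | 0 => hsum | _ + 1 => fun _ _ _ _ => PUnit.unit)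
    (fun {m} => match m with | 0 => hprod | _ + 1 => fun _ _ _ _ => PUnit.unit)
    (fun {m} => match m with | 0 => harr | _ + 1 => fun _ _ _ _ => PUnit.unit)
    (fun {m} => match m with | 0 => fun τ _ => hmu τ | _ + 1 => fun _ _ => PUnit.unit) τ

end Ty

end FPC

namespace FPC

namespace Ty

/-! ## The `▷`-algebra structure on the interpretation of closed types -/

/-- The type `Π τ. ▷ ⟦τ⟧ → ⟦τ⟧`. -/
noncomputable abbrev tickType : Tree :=
  Tree.pi (Ty 0) (fun τ => Tree.exp (Tree.later (den τ)) (den τ))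

/-- The clauses defining `θ`, by structural recursion on the type, from the assumption that `θ` is
available later:
* `θ₁ x = θ x` and `θ_{σ+τ} x = θ x`, for the structure maps of `L`;
* `θ_{σ×τ} x = ⟨θ_σ (▷π₁ x), θ_τ (▷π₂ x)⟩`;
* `θ_{σ→τ} f = λ x. θ_τ (f ⊛ next x)`;
* `θ_{μα.τ} x = θ' ⊛ x`, where `θ' : ▷ (▷ ⟦τ[μα.τ/α]⟧ → ⟦τ[μα.τ/α]⟧)` is the assumption. -/
noncomputable def tickStep : ∀ τ : Ty 0,
    Tree.Hom (Tree.prod (Tree.later tickType) (Tree.later (den τ))) (den τ) :=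
  recClosed
    (P := fun τ => Tree.Hom (Tree.prod (Tree.later tickType) (Tree.later (den τ))) (den τ))
    (Tree.comp (Tree.tickLift _) (Tree.sndHom _ _))
    (fun _ _ _ _ => Tree.comp (Tree.tickLift _) (Tree.sndHom _ _))
    (fun _ _ tσ tτ => Tree.pairHom
      (Tree.comp tσ (Tree.pairHom (Tree.fstHom _ _)
        (Tree.comp (Tree.laterMap (Tree.fstHom _ _)) (Tree.sndHom _ _))))
      (Tree.comp tτ (Tree.pairHom (Tree.fstHom _ _)
        (Tree.comp (Tree.laterMap (Tree.sndHom _ _)) (Tree.sndHom _ _)))))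
    (fun σ τ _ tτ => Tree.curry (Tree.comp tτ (Tree.pairHom
      (Tree.comp (Tree.fstHom _ _) (Tree.fstHom _ _))
      (Tree.comp (Tree.laterApp (den σ) (den τ)) (Tree.pairHom
        (Tree.comp (Tree.sndHom _ _) (Tree.fstHom _ _))
        (Tree.comp (Tree.next _) (Tree.sndHom _ _)))))))
    (fun τ => Tree.comp (roll τ) (Tree.comp
      (Tree.laterApp (Tree.later (den (unfold τ))) (den (unfold τ)))
      (Tree.pairHom
        (Tree.comp (Tree.laterMap (Tree.proj _ (unfold τ))) (Tree.fstHom _ _))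
        (Tree.comp (Tree.laterMap (unroll τ)) (Tree.sndHom _ _)))))

/-- `θ : Π τ. ▷ ⟦τ⟧ → ⟦τ⟧`, as a guarded fixed point. -/
noncomputable def tickAll : Tree.Global tickType :=
  Tree.fixElt (Tree.tuple fun τ => Tree.curry (tickStep τ))

/-- `θ_τ : ▷ ⟦τ⟧ → ⟦τ⟧`. -/
noncomputable def tick (τ : Ty 0) : Tree.Hom (Tree.later (den τ)) (den τ) :=
  Tree.comp (Tree.evalHom _ _)
    (Tree.pairHom (Tree.comp (Tree.proj _ τ) (tickAll.toHom _)) (Tree.idHom _))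

end Ty

/-! ## Terms, typing, and operational semantics -/

/-- Terms of FPC (de Bruijn indices). -/
inductive Tm : Type
  | unit
  | var (i : ℕ)
  | inl (M : Tm)
  | inr (M : Tm)
  | case (L M N : Tm)
  | pair (M N : Tm)
  | fst (M : Tm)
  | snd (M : Tm)
  | lam (σ : Ty 0) (M : Tm)
  | app (M N : Tm)
  | fold (M : Tm)
  | unfold (M : Tm)

namespace Tm

/-- The extension of a renaming under a binder. -/
def liftRen (r : ℕ → ℕ) : ℕ → ℕ
  | 0 => 0
  | i + 1 => r i + 1

def rename : (ℕ → ℕ) → Tm → Tm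
  | _, unit => unit
  | r, var i => var (r i)
  | r, inl M => inl (rename r M)
  | r, inr M => inr (rename r M)
  | r, case L M N => case (rename r L) (rename (liftRen r) M) (rename (liftRen r) N)
  | r, pair M N => pair (rename r M) (rename r N)
  | r, fst M => fst (rename r M)
  | r, snd M => snd (rename r M)
  | r, lam σ M => lam σ (rename (liftRen r) M)
  | r, app M N => app (rename r M) (rename r N)
  | r, fold M => fold (rename r M)
  | r, unfold M => unfold (rename r M)

/-- The extension of a substitution under a binder. -/
def liftSub (s : ℕ → Tm) : ℕ → Tm
  | 0 => var 0
  | i + 1 => rename Nat.succ (s i)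

/-- Capture-avoiding simultaneous substitution. -/
def subst : (ℕ → Tm) → Tm → Tm
  | _, unit => unit
  | s, var i => s i
  | s, inl M => inl (subst s M)
  | s, inr M => inr (subst s M)
  | s, case L M N => case (subst s L) (subst (liftSub s) M) (subst (liftSub s) N)
  | s, pair M N => pair (subst s M) (subst s N)
  | s, fst M => fst (subst s M)
  | s, snd M => snd (subst s M)
  | s, lam σ M => lam σ (subst (liftSub s) M)
  | s, app M N => app (subst s M) (subst s N)
  | s, fold M => fold (subst s M)
  | s, unfold M => unfold (subst s M)

/-- `M[N/x]`, where `x` is the variable with index `0`. -/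
def inst (M N : Tm) : Tm :=
  subst (fun i => match i with | 0 => N | i + 1 => var i) M

end Tm

/-- `Lookup Γ i σ`: the variable with index `i` has type `σ` in `Γ`. -/
inductive Lookup : List (Ty 0) → ℕ → Ty 0 → Type
  | zero {Γ : List (Ty 0)} {σ : Ty 0} : Lookup (σ :: Γ) 0 σ
  | succ {Γ : List (Ty 0)} {i : ℕ} {σ ρ : Ty 0} : Lookup Γ i σ → Lookup (ρ :: Γ) (i + 1) σ

/-- Derivations of the typing judgement `Γ ⊢ M : τ`. -/
inductive HasType : List (Ty 0) → Tm → Ty 0 → Type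
  | var {Γ : List (Ty 0)} {i : ℕ} {σ : Ty 0} : Lookup Γ i σ → HasType Γ (.var i) σ
  | unit {Γ : List (Ty 0)} : HasType Γ .unit .one
  | lam {Γ : List (Ty 0)} {σ τ : Ty 0} {M : Tm} :
      HasType (σ :: Γ) M τ → HasType Γ (.lam σ M) (.arr σ τ)
  | app {Γ : List (Ty 0)} {σ τ : Ty 0} {M N : Tm} :
      HasType Γ M (.arr σ τ) → HasType Γ N σ → HasType Γ (.app M N) τ
  | inl {Γ : List (Ty 0)} {τ₁ τ₂ : Ty 0} {M : Tm} :
      HasType Γ M τ₁ → HasType Γ (.inl M) (.sum τ₁ τ₂)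
  | inr {Γ : List (Ty 0)} {τ₁ τ₂ : Ty 0} {M : Tm} :
      HasType Γ M τ₂ → HasType Γ (.inr M) (.sum τ₁ τ₂)
  | case {Γ : List (Ty 0)} {τ₁ τ₂ σ : Ty 0} {L M N : Tm} :
      HasType Γ L (.sum τ₁ τ₂) → HasType (τ₁ :: Γ) M σ → HasType (τ₂ :: Γ) N σ →
        HasType Γ (.case L M N) σ
  | fst {Γ : List (Ty 0)} {τ₁ τ₂ : Ty 0} {M : Tm} :
      HasType Γ M (.prod τ₁ τ₂) → HasType Γ (.fst M) τ₁
  | snd {Γ : List (Ty 0)} {τ₁ τ₂ : Ty 0} {M : Tm} :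
      HasType Γ M (.prod τ₁ τ₂) → HasType Γ (.snd M) τ₂
  | pair {Γ : List (Ty 0)} {τ₁ τ₂ : Ty 0} {M N : Tm} :
      HasType Γ M τ₁ → HasType Γ N τ₂ → HasType Γ (.pair M N) (.prod τ₁ τ₂)
  | unfold {Γ : List (Ty 0)} {τ : Ty 1} {M : Tm} :
      HasType Γ M (.mu τ) → HasType Γ (.unfold M) τ.unfold
  | fold {Γ : List (Ty 0)} {τ : Ty 1} {M : Tm} :
      HasType Γ M τ.unfold → HasType Γ (.fold M) (.mu τ)

/-- The shape of values. -/
inductive IsValue : Tm → Prop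
  | unit : IsValue .unit
  | inl (M : Tm) : IsValue (.inl M)
  | inr (M : Tm) : IsValue (.inr M)
  | pair (M N : Tm) : IsValue (.pair M N)
  | lam (σ : Ty 0) (M : Tm) : IsValue (.lam σ M)
  | fold (M : Tm) : IsValue (.fold M)

/-- The call-by-name big-step semantics `M ⇓ᵏ v`, where `k` counts the unfold-fold reductions. -/
inductive Eval : Tm → ℕ → Tm → Prop
  | value {v : Tm} : IsValue v → Eval v 0 v
  | caseInl {L L' M N v : Tm} {k m : ℕ} :
      Eval L k (.inl L') → Eval (M.inst L') m v → Eval (.case L M N) (m + k) v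
  | caseInr {L L' M N v : Tm} {k m : ℕ} :
      Eval L k (.inr L') → Eval (N.inst L') m v → Eval (.case L M N) (m + k) v
  | fst {L M N v : Tm} {k l : ℕ} : Eval L k (.pair M N) → Eval M l v → Eval (.fst L) (k + l) v
  | snd {L M N v : Tm} {k l : ℕ} : Eval L k (.pair M N) → Eval N l v → Eval (.snd L) (k + l) v
  | app {M N L v : Tm} {σ : Ty 0} {k l : ℕ} :
      Eval M k (.lam σ L) → Eval (L.inst N) l v → Eval (.app M N) (k + l) v
  | unfold {M N v : Tm} {k m : ℕ} :
      Eval M k (.fold N) → Eval N m v → Eval (.unfold M) (k + m + 1) v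

/-- `M ⇓ v`, ignoring the number of steps. -/
def EvalsTo (M v : Tm) : Prop := ∃ k, Eval M k v

/-! ## Contexts and contextual equivalence -/

/-- Program contexts: terms with one hole. -/
inductive Cxt : Type
  | hole
  | lam (σ : Ty 0) (C : Cxt)
  | appL (C : Cxt) (N : Tm)
  | appR (M : Tm) (C : Cxt)
  | inl (C : Cxt)
  | inr (C : Cxt)
  | pairL (C : Cxt) (N : Tm)
  | pairR (M : Tm) (C : Cxt)
  | fst (C : Cxt)
  | snd (C : Cxt)
  | case (C : Cxt) (M N : Tm)
  | caseL (L : Tm) (C : Cxt) (N : Tm)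
  | caseR (L M : Tm) (C : Cxt)
  | unfold (C : Cxt)
  | fold (C : Cxt)

/-- `C[M]`, filling the hole; this may capture free variables of `M`. -/
def Cxt.fill : Cxt → Tm → Tm
  | hole, P => P
  | lam σ C, P => .lam σ (C.fill P)
  | appL C N, P => .app (C.fill P) N
  | appR M C, P => .app M (C.fill P)
  | inl C, P => .inl (C.fill P)
  | inr C, P => .inr (C.fill P)
  | pairL C N, P => .pair (C.fill P) N
  | pairR M C, P => .pair M (C.fill P)
  | fst C, P => .fst (C.fill P)
  | snd C, P => .snd (C.fill P)
  | case C M N, P => .case (C.fill P) M N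
  | caseL L C N, P => .case L (C.fill P) N
  | caseR L M C, P => .case L M (C.fill P)
  | unfold C, P => .unfold (C.fill P)
  | fold C, P => .fold (C.fill P)

/-- `CxtType Γ τ C Δ σ`: the context `C` has type `(Γ, τ) → (Δ, σ)`. -/
inductive CxtType (Γ : List (Ty 0)) (τ : Ty 0) : Cxt → List (Ty 0) → Ty 0 → Prop
  | hole : CxtType Γ τ .hole Γ τ
  | lam {Δ : List (Ty 0)} {σ' σ : Ty 0} {C : Cxt} :
      CxtType Γ τ C (σ' :: Δ) σ → CxtType Γ τ (.lam σ' C) Δ (.arr σ' σ)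
  | appL {Δ : List (Ty 0)} {σ' σ : Ty 0} {C : Cxt} {N : Tm} :
      CxtType Γ τ C Δ (.arr σ' σ) → HasType Δ N σ' → CxtType Γ τ (.appL C N) Δ σ
  | appR {Δ : List (Ty 0)} {σ' σ : Ty 0} {C : Cxt} {M : Tm} :
      CxtType Γ τ C Δ σ' → HasType Δ M (.arr σ' σ) → CxtType Γ τ (.appR M C) Δ σ
  | unfold {Δ : List (Ty 0)} {σ : Ty 1} {C : Cxt} :
      CxtType Γ τ C Δ (.mu σ) → CxtType Γ τ (.unfold C) Δ σ.unfold
  | fold {Δ : List (Ty 0)} {σ : Ty 1} {C : Cxt} :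
      CxtType Γ τ C Δ σ.unfold → CxtType Γ τ (.fold C) Δ (.mu σ)
  | fst {Δ : List (Ty 0)} {τ₁ τ₂ : Ty 0} {C : Cxt} :
      CxtType Γ τ C Δ (.prod τ₁ τ₂) → CxtType Γ τ (.fst C) Δ τ₁
  | snd {Δ : List (Ty 0)} {τ₁ τ₂ : Ty 0} {C : Cxt} :
      CxtType Γ τ C Δ (.prod τ₁ τ₂) → CxtType Γ τ (.snd C) Δ τ₂
  | pairL {Δ : List (Ty 0)} {τ₁ τ₂ : Ty 0} {C : Cxt} {N : Tm} :
      CxtType Γ τ C Δ τ₁ → HasType Δ N τ₂ → CxtType Γ τ (.pairL C N) Δ (.prod τ₁ τ₂)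
  | pairR {Δ : List (Ty 0)} {τ₁ τ₂ : Ty 0} {C : Cxt} {M : Tm} :
      CxtType Γ τ C Δ τ₂ → HasType Δ M τ₁ → CxtType Γ τ (.pairR M C) Δ (.prod τ₁ τ₂)
  | case {Δ : List (Ty 0)} {τ₁ τ₂ σ : Ty 0} {C : Cxt} {M N : Tm} :
      CxtType Γ τ C Δ (.sum τ₁ τ₂) → HasType (τ₁ :: Δ) M σ → HasType (τ₂ :: Δ) N σ →
        CxtType Γ τ (.case C M N) Δ σ
  | caseL {Δ : List (Ty 0)} {τ₁ τ₂ σ : Ty 0} {C : Cxt} {L N : Tm} :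
      HasType Δ L (.sum τ₁ τ₂) → CxtType Γ τ C (τ₁ :: Δ) σ → HasType (τ₂ :: Δ) N σ →
        CxtType Γ τ (.caseL L C N) Δ σ
  | caseR {Δ : List (Ty 0)} {τ₁ τ₂ σ : Ty 0} {C : Cxt} {L M : Tm} :
      HasType Δ L (.sum τ₁ τ₂) → HasType (τ₁ :: Δ) M σ → CxtType Γ τ C (τ₂ :: Δ) σ →
        CxtType Γ τ (.caseR L M C) Δ σ
  | inl {Δ : List (Ty 0)} {τ₁ τ₂ : Ty 0} {C : Cxt} :
      CxtType Γ τ C Δ τ₁ → CxtType Γ τ (.inl C) Δ (.sum τ₁ τ₂)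
  | inr {Δ : List (Ty 0)} {τ₁ τ₂ : Ty 0} {C : Cxt} :
      CxtType Γ τ C Δ τ₂ → CxtType Γ τ (.inr C) Δ (.sum τ₁ τ₂)

/-- Contextual equivalence of terms `M, N` with `Γ ⊢ M, N : τ`: no closing context of unit type
distinguishes them by termination. -/
def CtxEquiv (Γ : List (Ty 0)) (τ : Ty 0) (M N : Tm) : Prop :=
  ∀ C : Cxt, CxtType Γ τ C [] .one →
    (EvalsTo (C.fill M) .unit ↔ EvalsTo (C.fill N) .unit)

/-! ## Interpretation of terms -/

/-- `⟦Γ⟧`, the product of the interpretations of the types in `Γ`. -/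
noncomputable def denCtx : List (Ty 0) → Tree
  | [] => Tree.one
  | σ :: Γ => Tree.prod (denCtx Γ) σ.den

/-- The projection `⟦Γ⟧ → ⟦σ⟧` at a variable. -/
noncomputable def Lookup.den : {Γ : List (Ty 0)} → {i : ℕ} → {σ : Ty 0} → Lookup Γ i σ →
    Tree.Hom (denCtx Γ) σ.den
  | _, _, _, zero => Tree.sndHom _ _
  | _, _, _, succ x => Tree.comp x.den (Tree.fstHom _ _)

/-- The interpretation `⟦Γ ⊢ M : τ⟧ : ⟦Γ⟧ → ⟦τ⟧`. -/
noncomputable def HasType.den : {Γ : List (Ty 0)} → {M : Tm} → {τ : Ty 0} → HasType Γ M τ →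
    Tree.Hom (denCtx Γ) τ.den
  | _, _, _, var x => x.den
  | _, _, _, unit => Tree.comp (Tree.now _) (Tree.toOne _)
  | _, _, _, lam d => Tree.curry d.den
  | _, _, _, app d e => Tree.comp (Tree.evalHom _ _) (Tree.pairHom d.den e.den)
  | _, _, _, inl d => Tree.comp (Tree.now _) (Tree.comp (Tree.inlHom _ _) d.den)
  | _, _, _, inr d => Tree.comp (Tree.now _) (Tree.comp (Tree.inrHom _ _) d.den)
  | _, _, _, case (σ := σ) d e f =>
      Tree.comp (Tree.extend σ.tick (Tree.caseHom e.den f.den)) (Tree.pairHom (Tree.idHom _) d.den)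
  | _, _, _, fst d => Tree.comp (Tree.fstHom _ _) d.den
  | _, _, _, snd d => Tree.comp (Tree.sndHom _ _) d.den
  | _, _, _, pair d e => Tree.pairHom d.den e.den
  | _, _, _, unfold (τ := τ) d => Tree.comp τ.unfold.tick (Tree.comp (Ty.unroll τ) d.den)
  | _, _, _, fold (τ := τ) d => Tree.comp (Ty.roll τ) (Tree.comp (Tree.next _) d.den)

/-- The global interpretation `Λ κ. ⟦M⟧ : ∀ κ. (⟦Γ⟧ → ⟦τ⟧)`. -/
noncomputable def HasType.denGlobal {Γ : List (Ty 0)} {M : Tm} {τ : Ty 0} (d : HasType Γ M τ) :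
    Tree.Global (Tree.exp (denCtx Γ) τ.den) :=
  ⟨fun _ => ⟨fun i _ => d.den.app i, fun i _ => d.den.nat i⟩, fun _ => rfl⟩

/-! ## The weak bisimulation relation -/

namespace Fam

/-- The families `R` and `S` coincide below stage `n`. -/
def AgreeRel {B : Tree} (n : ℕ) (R S : Fam B) : Prop := R.trunc n = S.trunc n

theorem AgreeRel.reindex {A B : Tree} {n : ℕ} (f : Tree.Hom A B) {R S : Fam B}
    (h : AgreeRel n R S) : AgreeRel n (R.reindex f) (S.reindex f) := by
  let g : FamT B n → FamT A n := fun r =>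
    ⟨fun k hk a => r.obj k hk (f.app k a),
      fun k hk a a' e x => r.res k hk _ _ (by rw [f.nat, e]) x⟩
  exact congrArg g h

theorem AgreeRel.prodRel {A A' B B' : Tree} {n : ℕ} {R R' : Rel A A'} {S S' : Rel B B'}
    (hR : AgreeRel n R R') (hS : AgreeRel n S S') : AgreeRel n (prodRel R S) (prodRel R' S') := by
  let g : FamT (Tree.prod A A') n → FamT (Tree.prod B B') n →
      FamT (Tree.prod (Tree.prod A B) (Tree.prod A' B')) n := fun r s =>
    ⟨fun k hk p => r.obj k hk (p.1.1, p.2.1) × s.obj k hk (p.1.2, p.2.2),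
      fun k hk p p' h e => (r.res k hk _ _ (by subst h; rfl) e.1,
        s.res k hk _ _ (by subst h; rfl) e.2)⟩
  exact congrArg₂ g hR hS

theorem AgreeRel.sumRel {A A' B B' : Tree} {n : ℕ} {R R' : Rel A A'} {S S' : Rel B B'}
    (hR : AgreeRel n R R') (hS : AgreeRel n S S') : AgreeRel n (sumRel R S) (sumRel R' S') := by
  let g : FamT (Tree.prod A A') n → FamT (Tree.prod B B') n →
      FamT (Tree.prod (Tree.sum A B) (Tree.sum A' B')) n := fun r s =>
    ⟨fun k hk p => sumRelObj (r.obj k hk) (s.obj k hk) p.1 p.2,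
      fun k hk p p' h => match p', h with
        | _, rfl => sumRelRes (fun q => r.res k hk q _ rfl) (fun q => s.res k hk q _ rfl) p.1 p.2⟩
  exact congrArg₂ g hR hS

theorem AgreeRel.expRel {A A' B B' : Tree} {n : ℕ} {R R' : Rel A A'} {S S' : Rel B B'}
    (hR : AgreeRel n R R') (hS : AgreeRel n S S') : AgreeRel n (expRel R S) (expRel R' S') := by
  let g : FamT (Tree.prod A A') n → FamT (Tree.prod B B') n →
      FamT (Tree.prod (Tree.exp A B) (Tree.exp A' B')) n := fun r s =>
    ⟨fun k hk p => {φ : ∀ i (h : i ≤ k) (q : A.obj i × A'.obj i),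
        r.obj i (h.trans_lt hk) q → s.obj i (h.trans_lt hk) (p.1.1 i h q.1, p.2.1 i h q.2) //
        ∀ i (h : i + 1 ≤ k) (q : A.obj (i + 1) × A'.obj (i + 1))
          (e : r.obj (i + 1) (h.trans_lt hk) q),
          s.res i (h.trans_lt hk) _ _ (Prod.mk.injEq .. ▸ ⟨p.1.2 i h q.1, p.2.2 i h q.2⟩)
            (φ (i + 1) h q e) =
          φ i (Nat.le_of_succ_le h) (A.res i q.1, A'.res i q.2)
            (r.res i (h.trans_lt hk) q _ rfl e)},
      fun k hk p p' h => match p', h with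
        | _, rfl => fun φ => ⟨fun i hi => φ.1 i (Nat.le_succ_of_le hi),
            fun i hi => φ.2 i (Nat.le_succ_of_le hi)⟩⟩
  exact congrArg₂ g hR hS

theorem AgreeRel.laterRel {A A' : Tree} {n : ℕ} {R R' : Rel A A'} (hR : AgreeRel n R R') :
    AgreeRel (n + 1) (laterRel R) (laterRel R') := by
  obtain ⟨h1, h2⟩ := trunc_eq_iff.1 hR
  refine trunc_eq_iff.2 ⟨fun k hk b => ?_, fun k hk b b' e x => ?_⟩
  · cases k with
    | zero => rfl
    | succ k => exact h1 k (Nat.lt_of_succ_lt_succ hk) b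
  · cases k with
    | zero => rfl
    | succ k => exact h2 k (Nat.lt_of_succ_lt_succ hk) b b' e x

theorem AgreeRel.liftRel {A B : Tree} {n : ℕ} {R R' : Rel A B} (hR : AgreeRel n R R') :
    AgreeRel n (liftRel R) (liftRel R') := by
  let X : Tree := ⟨A.liftTailObj, A.liftTailRes⟩
  let Y : Tree := ⟨B.liftTailObj, B.liftTailRes⟩
  let tail : Rel A B → Rel X Y := fun R => ⟨fun n p => liftRelTail R n p.1 p.2,
    fun n p p' h => match p', h with
      | _, rfl => liftRelTailRes R n p.1 p.2⟩
  have step : ∀ m, AgreeRel m R R' → AgreeRel m (tail R) (tail R') →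
      AgreeRel m (Fam.liftRel R) (Fam.liftRel R') := by
    intro m h h'
    let g : FamT (Tree.prod A B) m → FamT (Tree.prod X Y) m →
        FamT (Tree.prod (Tree.lift A) (Tree.lift B)) m := fun r t =>
      ⟨fun k hk p => liftRelStep k (r.obj k hk) (fun x y => t.obj k hk (x, y)) p.1 p.2,
        fun k hk p p' h => match p', h with
          | _, rfl => liftRelStepRes (fun q => r.res k hk q _ rfl)
              (fun x y => t.res k hk (x, y) _ rfl) p.1 p.2⟩
    exact congrArg₂ g h h'
  have tl : ∀ m, m ≤ n → AgreeRel m (tail R) (tail R') := by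
    intro m
    induction m with
    | zero => exact fun _ => trunc_zero _ _
    | succ m ih =>
      intro hm
      obtain ⟨h1, h2⟩ := trunc_eq_iff.1
        (step m (trunc_mono (Nat.le_of_succ_le hm) hR) (ih (Nat.le_of_succ_le hm)))
      refine trunc_eq_iff.2 ⟨fun k hk b => ?_, fun k hk b b' e x => ?_⟩
      · cases k with
        | zero => rfl
        | succ k => exact h1 k (Nat.lt_of_succ_lt_succ hk) b
      · cases k with
        | zero => rfl
        | succ k =>
          subst e
          exact h2 k (Nat.lt_of_succ_lt_succ hk) b _ rfl x
  exact step n hR (tl n le_rfl)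

end Fam

namespace Ty

/-- The clauses defining the relation `≈`, by structural recursion on the type, where `X` is the
relation to be used later:
* `x ≈₁ y` is `x L(=) y`;
* `x ≈_{σ+τ} y` is `x L(≈_σ + ≈_τ) y`;
* `x ≈_{σ×τ} y` is `π₁ x ≈_σ π₁ y` and `π₂ x ≈_τ π₂ y`;
* `f ≈_{σ→τ} g` is `Π x y. x ≈_σ y → f x ≈_τ g y`;
* `x ≈_{μα.τ} y` is `x (▷ X_{τ[μα.τ/α]}) y`. -/
noncomputable def bisimStep (X : ∀ τ : Ty 0, Rel (den τ) (den τ)) :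
    ∀ τ : Ty 0, Rel (den τ) (den τ) :=
  recClosed (P := fun τ => Rel (den τ) (den τ))
    (Fam.liftRel (Fam.eqRel Tree.one))
    (fun _ _ R S => Fam.liftRel (Fam.sumRel R S))
    (fun _ _ R S => Fam.prodRel R S)
    (fun _ _ R S => Fam.expRel R S)
    (fun τ => Fam.reindex
      (Tree.pairHom (Tree.comp (unroll τ) (Tree.fstHom _ _))
        (Tree.comp (unroll τ) (Tree.sndHom _ _)))
      (Fam.laterRel (X (unfold τ))))

theorem existsUnique_bisim : ∃! X, bisimStep X = X := by
  refine Fam.existsUnique_fix bisimStep fun n X Y h τ => ?_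
  change Fam.AgreeRel (n + 1) (bisimStep X τ) (bisimStep Y τ)
  induction τ using recClosed with
  | hone => rfl
  | hsum σ τ ihσ ihτ => exact (Fam.AgreeRel.sumRel ihσ ihτ).liftRel
  | hprod σ τ ihσ ihτ => exact Fam.AgreeRel.prodRel ihσ ihτ
  | harr σ τ ihσ ihτ => exact Fam.AgreeRel.expRel ihσ ihτ
  | hmu τ => exact Fam.AgreeRel.reindex _ (Fam.AgreeRel.laterRel (h (unfold τ)))

/-- The weak bisimulation relation `≈_τ` on `⟦τ⟧`: the unique solution of its guarded recursive
definition. -/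
noncomputable def bisim : ∀ τ : Ty 0, Rel (den τ) (den τ) := existsUnique_bisim.choose

theorem bisim_eq : bisimStep bisim = bisim := existsUnique_bisim.choose_spec.1

end Ty

/-- The relation `x⃗ ≈_{σ⃗} y⃗` on `⟦Γ⟧`. -/
noncomputable def bisimCtx : ∀ Γ : List (Ty 0), Rel (denCtx Γ) (denCtx Γ)
  | [] => Fam.eqRel Tree.one
  | σ :: Γ => Fam.prodRel (bisimCtx Γ) σ.bisim

/-- The relation `≈_{Γ,τ}` on `⟦Γ⟧ → ⟦τ⟧`. -/
noncomputable def bisimOpen (Γ : List (Ty 0)) (τ : Ty 0) :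
    Rel (Tree.exp (denCtx Γ) τ.den) (Tree.exp (denCtx Γ) τ.den) :=
  Fam.expRel (bisimCtx Γ) τ.bisim

/-- The relation `x ≈ᵍˡ_{Γ,τ} y`, that is `∀ κ. x[κ] ≈_{Γ,τ} y[κ]`, for
`x, y : ∀ κ. (⟦Γ⟧ → ⟦τ⟧)`. -/
def BisimGlobal (Γ : List (Ty 0)) (τ : Ty 0)
    (x y : Tree.Global (Tree.exp (denCtx Γ) τ.den)) : Type :=
  Fam.Global (bisimOpen Γ τ) ⟨fun n => (x.1 n, y.1 n), fun n => Prod.ext (x.2 n) (y.2 n)⟩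

end FPC

/-!
The theorem combines three facts about the interpretation of FPC in the topos of trees.

Weak bisimilarity is a congruence (`Bisimilar.fill`). Relations are proof-relevant, so relatedness
of two morphisms means that there is a natural family of witnesses (`Respects`). All the morphisms
from which denotations are built respect the relations `≈`; guarded recursive morphisms do so by
Löb induction (`respects_loeb`). The interesting case is the extension of a map to the lifting
monad (`Respects.extend`): since `L R` may relate a value to a delayed value, it requires that
`x ≈ y` implies `x ≈ δ y` and `δ x ≈ y` at every type, which again holds by Löb induction from the
case of the lifting monad (`Structural.respects`).

Evaluation is reflected by denotations, in both directions. If `M ⇓ᵏ v`, then `⟦M⟧ = δᵏ ⟦v⟧`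
(`Eval.den_eq`), by a substitution lemma for derivations and because eliminators commute with `δ`.
Derivations are not unique, so the substitution lemma produces a derivation together with its
denotation. Conversely, if the denotation of a closed term of unit type terminates, then so does
the term; this follows from a step-indexed logical relation between denotations and terms (`Approx`,
`approx_den`). For this purpose the relation can ignore the number of evaluation steps.

Weak bisimilarity of global elements of `L 1` preserves termination (`exists_isSome_result`). At a
single stage `n` this fails, as a delay by more than `n` steps looks like divergence there, but the
number of steps recorded in a global witness does not depend on the stage.
-/

namespace FPC

/-! ### Iterated restriction in presheaves and in types over them -/

namespace Tree

theorem Hom.resLE {A B : Tree} (f : Hom A B) {i n : ℕ} (h : i ≤ n) (a : A.obj n) :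
    B.resLE h (f.app n a) = f.app i (A.resLE h a) := by
  induction n, h using Nat.le_induction with
  | base => rw [resLE_self, resLE_self]
  | succ n h ih => rw [← resLE_res _ h, f.nat, ih, resLE_res]

theorem prod_resLE (A B : Tree) {i n : ℕ} (h : i ≤ n) (p : (prod A B).obj n) :
    (prod A B).resLE h p = (A.resLE h p.1, B.resLE h p.2) :=
  Prod.ext ((fstHom A B).resLE h p).symm ((sndHom A B).resLE h p).symm

end Tree

open FPC.Tree

namespace Fam

/-- The comprehension of a type `R` over `B`: the presheaf of pairs of an element of `B` and an
element of `R` over it. -/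
def total {B : Tree} (R : Fam B) : Tree where
  obj n := Σ b, R.obj n b
  res n p := ⟨B.res n p.1, R.res n p.1 _ rfl p.2⟩

/-- The projection from the comprehension of a type. -/
def totalFst {B : Tree} (R : Fam B) : Hom R.total B := ⟨fun _ p => p.1, fun _ _ => rfl⟩

/-- Restriction along `i ≤ n` in a type over `B`, into the fibre over an element `b'` that is
only propositionally equal to the restriction of `b`. -/
def resTo {B : Tree} (R : Fam B) {i n : ℕ} (h : i ≤ n) {b : B.obj n} {b' : B.obj i}
    (hb : B.resLE h b = b') (e : R.obj n b) : R.obj i b' :=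
  cast (congrArg (R.obj i) ((R.totalFst.resLE h ⟨b, e⟩).symm.trans hb)) (R.total.resLE h ⟨b, e⟩).2

theorem mk_resTo {B : Tree} (R : Fam B) {i n : ℕ} (h : i ≤ n) {b : B.obj n} {b' : B.obj i}
    (hb : B.resLE h b = b') (e : R.obj n b) :
    (⟨b', R.resTo h hb e⟩ : Σ b, R.obj i b) = R.total.resLE h ⟨b, e⟩ :=
  Sigma.ext ((R.totalFst.resLE h ⟨b, e⟩).symm.trans hb).symm (cast_heq _ _)

theorem res_resTo {B : Tree} (R : Fam B) {i n : ℕ} (h : i + 1 ≤ n) {b : B.obj n}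
    {b₁ : B.obj (i + 1)} {b₂ : B.obj i} (hb : B.resLE h b = b₁) (h₁ : B.res i b₁ = b₂)
    (hb₂ : B.resLE (Nat.le_of_succ_le h) b = b₂) (e : R.obj n b) :
    R.res i b₁ b₂ h₁ (R.resTo h hb e) = R.resTo (Nat.le_of_succ_le h) hb₂ e := by
  subst h₁
  exact eq_of_heq (Sigma.mk.inj ((congrArg (R.total.res i) (R.mk_resTo h hb e)).trans
    ((R.total.res_resLE h _).trans (R.mk_resTo (Nat.le_of_succ_le h) hb₂ e).symm))).2

theorem resTo_res {B : Tree} (R : Fam B) {i n : ℕ} (h : i ≤ n) {b : B.obj (n + 1)}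
    {b₁ : B.obj n} {b₂ b₃ : B.obj i} (h₁ : B.res n b = b₁) (hb : B.resLE h b₁ = b₂)
    (hb₃ : B.resLE (Nat.le_succ_of_le h) b = b₃) (e : R.obj (n + 1) b) :
    (⟨b₂, R.resTo h hb (R.res n b b₁ h₁ e)⟩ : Σ b, R.obj i b) =
      ⟨b₃, R.resTo (Nat.le_succ_of_le h) hb₃ e⟩ := by
  subst h₁
  exact (R.mk_resTo h hb _).trans ((R.total.resLE_res h ⟨b, e⟩).trans (R.mk_resTo _ hb₃ e).symm)

/-- Two elements of a restriction in `R → S` agree when they agree as families of maps. -/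
theorem expRel_res_eq {A A' B B' : Tree} {R : Rel A A'} {S : Rel B B'} {n : ℕ}
    {p : (Tree.prod (exp A B) (exp A' B')).obj (n + 1)}
    {p' : (Tree.prod (exp A B) (exp A' B')).obj n}
    (h : (Tree.prod (exp A B) (exp A' B')).res n p = p')
    (φ : (expRel R S).obj (n + 1) p) (ψ : (expRel R S).obj n p')
    (H : ∀ i (hi : i ≤ n) q r, HEq (φ.1 i (Nat.le_succ_of_le hi) q r) (ψ.1 i hi q r)) :
    (expRel R S).res n p p' h φ = ψ := by
  subst h
  apply Subtype.ext
  funext i hi q r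
  exact eq_of_heq (H i hi q r)

/-! ### Morphisms that respect proof-relevant relations -/

/-- The pair of `f` and `f'` is natural. -/
theorem app_res_eq {A A' B B' : Tree} (f : Hom A B) (f' : Hom A' B') {n : ℕ}
    {q : (Tree.prod A A').obj (n + 1)} {q' : (Tree.prod A A').obj n}
    (h : (Tree.prod A A').res n q = q') :
    (Tree.prod B B').res n (f.app (n + 1) q.1, f'.app (n + 1) q.2) =
      (f.app n q'.1, f'.app n q'.2) := by
  subst h
  exact Prod.ext (f.nat _ _) (f'.nat _ _)

/-- The morphisms `f` and `f'` take `R`-related arguments to `S`-related results: the type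
`Π x y. x R y → f x S f' y` has a global element. -/
def Respects {A A' B B' : Tree} (R : Rel A A') (S : Rel B B') (f : Hom A B) (f' : Hom A' B') :
    Prop :=
  ∃ φ : ∀ n q, R.obj n q → S.obj n (f.app n q.1, f'.app n q.2),
    ∀ n q q' (h : (Tree.prod A A').res n q = q') e,
      S.res n _ _ (app_res_eq f f' h) (φ (n + 1) q e) = φ n q' (R.res n q q' h e)

namespace Respects

variable {A A' B B' C C' D D' : Tree}

theorem id (R : Rel A A') : Respects R R (idHom A) (idHom A') :=
  ⟨fun _ _ e => e, fun _ _ _ _ _ => rfl⟩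

theorem of_eq {R S : Rel A A'} (h : R = S) : Respects R S (idHom A) (idHom A') :=
  h ▸ Respects.id R

theorem comp {R : Rel A A'} {S : Rel B B'} {T : Rel C C'} {f : Hom A B} {f' : Hom A' B'}
    {g : Hom B C} {g' : Hom B' C'} (hg : Respects S T g g') (hf : Respects R S f f') :
    Respects R T (Tree.comp g f) (Tree.comp g' f') := by
  obtain ⟨φ, hφ⟩ := hf
  obtain ⟨ψ, hψ⟩ := hg
  refine ⟨fun n q e => ψ n _ (φ n q e), fun n q q' h e => ?_⟩
  exact (hψ n _ _ (app_res_eq f f' h) _).trans (congrArg (ψ n _) (hφ n q q' h e))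

theorem fst (R : Rel A A') (S : Rel B B') :
    Respects (prodRel R S) R (fstHom A B) (fstHom A' B') :=
  ⟨fun _ _ e => e.1, fun _ _ _ h _ => by subst h; rfl⟩

theorem snd (R : Rel A A') (S : Rel B B') :
    Respects (prodRel R S) S (sndHom A B) (sndHom A' B') :=
  ⟨fun _ _ e => e.2, fun _ _ _ h _ => by subst h; rfl⟩

theorem pair {R : Rel A A'} {S : Rel B B'} {T : Rel C C'} {f : Hom A B} {f' : Hom A' B'}
    {g : Hom A C} {g' : Hom A' C'} (hf : Respects R S f f') (hg : Respects R T g g') :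
    Respects R (prodRel S T) (pairHom f g) (pairHom f' g') := by
  obtain ⟨φ, hφ⟩ := hf
  obtain ⟨ψ, hψ⟩ := hg
  exact ⟨fun n q e => (φ n q e, ψ n q e), fun n q q' h e =>
    Prod.ext (hφ n q q' h e) (hψ n q q' h e)⟩

theorem curry {K : Rel C C'} {R : Rel A A'} {S : Rel B B'} {f : Hom (Tree.prod C A) B}
    {f' : Hom (Tree.prod C' A') B'} (hf : Respects (prodRel K R) S f f') :
    Respects K (expRel R S) (Tree.curry f) (Tree.curry f') := by
  obtain ⟨φ, hφ⟩ := hf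
  refine ⟨fun n q k => ⟨fun i h p r => φ i ((C.resLE h q.1, p.1), (C'.resLE h q.2, p.2))
    (K.resTo h (prod_resLE C C' h q) k, r), fun i h p r => ?_⟩, fun n q q' h k => ?_⟩
  · refine (hφ i ((C.resLE h q.1, p.1), (C'.resLE h q.2, p.2))
      ((C.resLE (Nat.le_of_succ_le h) q.1, A.res i p.1),
      (C'.resLE (Nat.le_of_succ_le h) q.2, A'.res i p.2)) ?_ _).trans ?_
    · exact Prod.ext (Prod.ext (res_resLE _ _ _) rfl) (Prod.ext (res_resLE _ _ _) rfl)
    · refine congrArg (φ i _) (Prod.ext ?_ rfl)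
      exact K.res_resTo h (prod_resLE C C' h q) _ (prod_resLE C C' (Nat.le_of_succ_le h) q) k
  · apply expRel_res_eq
    intro i hi p r
    have key := K.resTo_res hi h (prod_resLE C C' hi q')
      (prod_resLE C C' (Nat.le_succ_of_le hi) q) k
    have aux : ∀ s t : Σ b, K.obj i b, s = t →
        HEq (φ i ((s.1.1, p.1), (s.1.2, p.2)) (s.2, r))
          (φ i ((t.1.1, p.1), (t.1.2, p.2)) (t.2, r)) := by
      rintro s t rfl; rfl
    exact aux _ _ key.symm

theorem eval (R : Rel A A') (S : Rel B B') :
    Respects (prodRel (expRel R S) R) S (evalHom A B) (evalHom A' B') :=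
  ⟨fun n q e => e.1.1 n le_rfl (q.1.2, q.2.2) e.2, fun n q q' h e => by
    subst h
    exact e.1.2 n le_rfl _ e.2⟩

theorem next (R : Rel A A') : Respects R (laterRel R) (Tree.next A) (Tree.next A') := by
  refine ⟨fun n => match n with
    | 0 => fun _ _ => PUnit.unit
    | n + 1 => fun q e => R.res n q _ rfl e, fun n q q' h e => ?_⟩
  subst h
  cases n <;> rfl

theorem laterMap {R : Rel A A'} {S : Rel B B'} {f : Hom A B} {f' : Hom A' B'}
    (hf : Respects R S f f') :
    Respects (laterRel R) (laterRel S) (Tree.laterMap f) (Tree.laterMap f') := by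
  obtain ⟨φ, hφ⟩ := hf
  refine ⟨fun n => match n with
    | 0 => fun _ _ => PUnit.unit
    | n + 1 => fun q e => φ n q e, fun n q q' h e => ?_⟩
  cases n with
  | zero => rfl
  | succ n => exact hφ n q q' h e

theorem laterPair (R : Rel A A') (S : Rel B B') :
    Respects (prodRel (laterRel R) (laterRel S)) (laterRel (prodRel R S))
      (Tree.laterPair A B) (Tree.laterPair A' B') := by
  refine ⟨fun n => match n with
    | 0 => fun _ _ => PUnit.unit
    | n + 1 => fun q e => e, fun n q q' h e => ?_⟩
  cases n <;> rfl

theorem laterApp (R : Rel A A') (S : Rel B B') :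
    Respects (prodRel (laterRel (expRel R S)) (laterRel R)) (laterRel S)
      (Tree.laterApp A B) (Tree.laterApp A' B') :=
  (eval R S).laterMap.comp (laterPair _ _)

theorem inl (R : Rel A A') (S : Rel B B') :
    Respects R (sumRel R S) (inlHom A B) (inlHom A' B') :=
  ⟨fun _ _ e => e, fun _ _ _ h _ => by subst h; rfl⟩

theorem inr (R : Rel A A') (S : Rel B B') :
    Respects S (sumRel R S) (inrHom A B) (inrHom A' B') :=
  ⟨fun _ _ e => e, fun _ _ _ h _ => by subst h; rfl⟩

theorem now (R : Rel A A') : Respects R (liftRel R) (Tree.now A) (Tree.now A') :=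
  ⟨fun _ _ e => e, fun _ _ _ h _ => by subst h; rfl⟩

theorem tickLift (R : Rel A A') :
    Respects (laterRel (liftRel R)) (liftRel R) (Tree.tickLift A) (Tree.tickLift A') := by
  refine ⟨fun n => match n with
    | 0 => fun _ _ => PUnit.unit
    | n + 1 => fun q e => e, fun n q q' h e => ?_⟩
  subst h
  cases n <;> rfl

theorem caseHom {K : Rel C C'} {R : Rel A A'} {S : Rel B B'} {T : Rel D D'}
    {f : Hom (Tree.prod C A) D} {f' : Hom (Tree.prod C' A') D'}
    {g : Hom (Tree.prod C B) D} {g' : Hom (Tree.prod C' B') D'}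
    (hf : Respects (prodRel K R) T f f') (hg : Respects (prodRel K S) T g g') :
    Respects (prodRel K (sumRel R S)) T (Tree.caseHom f g) (Tree.caseHom f' g') := by
  obtain ⟨φ, hφ⟩ := hf
  obtain ⟨ψ, hψ⟩ := hg
  let χ : ∀ n q, (prodRel K (sumRel R S)).obj n q →
      T.obj n ((Tree.caseHom f g).app n q.1, (Tree.caseHom f' g').app n q.2) := fun n q =>
    match q with
    | ((c, Sum.inl a), (c', Sum.inl a')) => fun e => φ n ((c, a), (c', a')) e
    | ((c, Sum.inr b), (c', Sum.inr b')) => fun e => ψ n ((c, b), (c', b')) e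
    | ((_, Sum.inl _), (_, Sum.inr _)) => fun e => nomatch e.2
    | ((_, Sum.inr _), (_, Sum.inl _)) => fun e => nomatch e.2
  refine ⟨χ, fun n q q' h e => ?_⟩
  subst h
  obtain ⟨⟨c, a | b⟩, ⟨c', a' | b'⟩⟩ := q
  · exact hφ n ((c, a), (c', a')) _ rfl e
  · exact nomatch e.2
  · exact nomatch e.2
  · exact hψ n ((c, b), (c', b')) _ rfl e

/-- Results in a reindexed relation are results in the original relation. -/
theorem reindex_intro {R : Rel A A'} {S : Rel B B'} {g : Hom C B} {g' : Hom C' B'}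
    {f : Hom A C} {f' : Hom A' C'} (h : Respects R S (Tree.comp g f) (Tree.comp g' f')) :
    Respects R (reindex (pairHom (Tree.comp g (fstHom C C')) (Tree.comp g' (sndHom C C'))) S)
      f f' :=
  h

theorem reindex_elim (S : Rel B B') (g : Hom C B) (g' : Hom C' B') :
    Respects (reindex (pairHom (Tree.comp g (fstHom C C')) (Tree.comp g' (sndHom C C'))) S) S
      g g' :=
  ⟨fun _ _ e => e, fun _ _ _ _ _ => rfl⟩

end Respects

/-! ### Guarded recursion for witnesses -/

/-- A presheaf as a relation on the terminal object. -/
def constRel (W : Tree) : Rel one one := ⟨fun n _ => W.obj n, fun n _ _ _ => W.res n⟩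

/-- The presheaf of witnesses that `f` and `f'` take `R`-related arguments to `S`-related results:
at stage `n`, families of witnesses at the stages `i ≤ n`. -/
def witness {A A' B B' : Tree} (R : Rel A A') (S : Rel B B') (f : Hom A B) (f' : Hom A' B') :
    Tree where
  obj n := (expRel R S).obj n (⟨fun i _ => f.app i, fun i _ => f.nat i⟩,
    ⟨fun i _ => f'.app i, fun i _ => f'.nat i⟩)
  res n := (expRel R S).res n _ _ rfl

/-- Löb induction: to show that a family of pairs of morphisms respects relations, one may assume
that it does so later. The assumption is a variable of a type `K`, hence the context `K`. -/
theorem respects_loeb {I : Type} {A A' B B' : I → Tree} {R : ∀ i, Rel (A i) (A' i)}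
    {S : ∀ i, Rel (B i) (B' i)} {f : ∀ i, Hom (A i) (B i)} {f' : ∀ i, Hom (A' i) (B' i)}
    (step : ∀ K : Rel one one,
      (∀ i, Respects (prodRel K (laterRel (R i))) (laterRel (S i))
        (comp (laterMap (f i)) (sndHom _ _)) (comp (laterMap (f' i)) (sndHom _ _))) →
      ∀ i, Respects (prodRel K (R i)) (S i)
        (comp (f i) (sndHom _ _)) (comp (f' i) (sndHom _ _))) (i : I) :
    Respects (R i) (S i) (f i) (f' i) := by
  -- The guarded fixed point is taken in the presheaf of witnesses.
  let W : Tree := Tree.pi I fun i => witness (R i) (S i) (f i) (f' i)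
  have hyp : ∀ i, Respects (prodRel (constRel (later W)) (laterRel (R i))) (laterRel (S i))
        (comp (laterMap (f i)) (sndHom _ _)) (comp (laterMap (f' i)) (sndHom _ _)) := by
    intro i
    refine ⟨fun n => match n with
      | 0 => fun _ _ => PUnit.unit
      | n + 1 => fun q e => (e.1 i).1 n le_rfl (q.1.2, q.2.2) e.2, fun n q q' h e => ?_⟩
    subst h
    cases n with
    | zero => rfl
    | succ n => exact (e.1 i).2 n le_rfl _ e.2
  choose φ hφ using step _ hyp
  let F : Hom (later W) W :=
    ⟨fun n k i => ⟨fun j h q r => φ i j ((PUnit.unit, q.1), (PUnit.unit, q.2))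
      ((later W).resLE h k, r), fun j h q r => by
        refine (hφ i j ((PUnit.unit, q.1), (PUnit.unit, q.2))
          ((PUnit.unit, (A i).res j q.1), (PUnit.unit, (A' i).res j q.2)) rfl
          _).trans ?_
        refine congrArg (φ i j _) (Prod.ext ?_ rfl)
        exact (later W).res_resLE h k⟩, fun n k => by
      funext i
      apply Subtype.ext
      funext j h q r
      exact congrArg (fun z => φ i j ((PUnit.unit, q.1), (PUnit.unit, q.2)) (z, r))
        ((later W).resLE_res h k).symm⟩
  let w : Tree.Global W := fixElt F
  refine ⟨fun n q e => (w.1 n i).1 n le_rfl q e, fun n q q' h e => ?_⟩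
  subst h
  have h1 := (w.1 (n + 1) i).2 n le_rfl q e
  have h2 := congrArg (fun z : W.obj n => (z i).1 n le_rfl ((A i).res n q.1, (A' i).res n q.2)
    ((R i).res n q _ rfl e)) (w.2 n)
  exact h1.trans h2

end Fam
end FPC

namespace FPC
open FPC.Tree

/-! ### The equations of the algebra structures `θ` -/

namespace Tree

theorem next_nat {A B : Tree} (f : Hom A B) :
    comp (next B) f = comp (laterMap f) (next A) := by
  ext n a
  cases n with
  | zero => rfl
  | succ n => exact f.nat n a

theorem laterMap_comp {A B C : Tree} (g : Hom B C) (f : Hom A B) :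
    laterMap (comp g f) = comp (laterMap g) (laterMap f) := by
  ext n a
  cases n <;> rfl

theorem laterMap_id (A : Tree) : laterMap (idHom A) = idHom (later A) := by
  ext n a
  cases n <;> rfl

/-- In presheaves over `ω`, the two canonical maps `▷ A → ▷ ▷ A` coincide. -/
theorem laterMap_next (A : Tree) : laterMap (next A) = next (later A) := by
  ext n a
  cases n with
  | zero => rfl
  | succ n => cases n <;> rfl

theorem homOfEq_homOfEq {A B : Tree} (h : A = B) (h' : B = A) :
    comp (homOfEq h) (homOfEq h') = idHom B := by
  subst h; rfl

theorem comp_curry {A B C D : Tree} (f : Hom (prod C A) B) (g : Hom D C) :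
    comp (curry f) g = curry (comp f (pairHom (comp g (fstHom _ _)) (sndHom _ _))) := by
  ext n d i h a
  exact congrArg (fun z => f.app i (z, a)) (g.resLE h d)

/-- Restriction of an exponential to stage `i` and evaluation there is evaluation at `i`. -/
theorem curry_eval {A B : Tree} : curry (evalHom A B) = idHom (exp A B) := by
  ext n f i h a
  change ((exp A B).resLE h f).1 i le_rfl a = f.1 i h a
  induction n, h using Nat.le_induction with
  | base => rw [resLE_self]
  | succ n h ih => rw [← resLE_res _ h]; exact ih _

end Tree

namespace Ty

theorem unroll_roll (τ : Ty 1) : comp (unroll τ) (roll τ) = idHom _ := homOfEq_homOfEq _ _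

/-- The recursive equation of `θ`: in `tickStep`, the assumption that `θ` is available later is
instantiated with `θ` itself. -/
theorem tick_eq (τ : Ty 0) : tick τ = comp (tickStep τ)
    (pairHom (comp (next tickType) (tickAll.toHom _)) (idHom _)) := by
  ext n x
  cases n with
  | zero => rfl
  | succ n =>
    change (tickStep τ).app (n + 1) ((later tickType).resLE le_rfl (tickAll.1 n), x) =
      (tickStep τ).app (n + 1) (tickType.res n (tickAll.1 (n + 1)), x)
    rw [resLE_self]
    exact congrArg (fun z => (tickStep τ).app (n + 1) (z, x)) (tickAll.2 n).symm

theorem tick_one : tick one = tickLift _ := by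
  rw [tick_eq]; rfl

theorem tick_sum (σ τ : Ty 0) : tick (sum σ τ) = tickLift _ := by
  rw [tick_eq]; rfl

theorem tick_prod (σ τ : Ty 0) : tick (prod σ τ) =
    pairHom (comp (tick σ) (laterMap (fstHom _ _))) (comp (tick τ) (laterMap (sndHom _ _))) := by
  rw [tick_eq, tick_eq σ, tick_eq τ]; rfl

theorem tick_arr (σ τ : Ty 0) : tick (arr σ τ) =
    curry (comp (tick τ) (comp (laterApp (den σ) (den τ))
      (pairHom (fstHom _ _) (comp (next _) (sndHom _ _))))) := by
  rw [tick_eq, tick_eq τ]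
  exact comp_curry _ _

theorem tick_mu (τ : Ty 1) : tick (mu τ) =
    comp (roll τ) (comp (laterMap (tick (unfold τ))) (laterMap (unroll τ))) := by
  rw [tick_eq]
  ext n x
  refine congrArg ((roll τ).app n) ?_
  cases n with
  | zero => rfl
  | succ n =>
    exact congrArg (fun k : tickType.obj n => (k (unfold τ)).1 n le_rfl ((unroll τ).app n x))
      (tickAll.2 n)

/-- `δ = θ ∘ next : ⟦τ⟧ → ⟦τ⟧`. -/
noncomputable def delay (τ : Ty 0) : Hom (den τ) (den τ) := comp (tick τ) (next _)

theorem delay_one : delay one = delayLift _ := by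
  rw [delay, tick_one]; rfl

theorem delay_sum (σ τ : Ty 0) : delay (sum σ τ) = delayLift _ := by
  rw [delay, tick_sum]; rfl

theorem delay_prod (σ τ : Ty 0) : delay (prod σ τ) =
    pairHom (comp (delay σ) (fstHom _ _)) (comp (delay τ) (sndHom _ _)) := by
  have h : ∀ {A B C : Tree} (t : Hom (later B) C) (f : Hom A B),
    comp (comp t (laterMap f)) (next A) = comp (comp t (next B)) f := fun t f =>
      (congrArg (comp t) (next_nat f)).symm
  rw [delay, tick_prod]
  exact congrArg₂ pairHom (h (tick σ) (fstHom (den σ) (den τ)))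
    (h (tick τ) (sndHom (den σ) (den τ)))

theorem delay_arr (σ τ : Ty 0) : delay (arr σ τ) = curry (comp (delay τ) (evalHom _ _)) := by
  rw [delay, tick_arr]
  refine (comp_curry _ _).trans (congrArg curry ?_)
  ext n p
  refine congrArg ((tick τ).app n) ?_
  cases n with
  | zero => rfl
  | succ n => exact (p.1.2 n le_rfl p.2).symm

theorem unroll_delay_mu (τ : Ty 1) :
    comp (unroll τ) (delay (mu τ)) = comp (laterMap (delay (unfold τ))) (unroll τ) := by
  have h := next_nat (unroll τ)
  ext n x
  rw [delay, tick_mu]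
  change ((comp (unroll τ) (roll τ)).app n _) = _
  rw [unroll_roll, delay, laterMap_comp, laterMap_next]
  exact congrArg (fun k : Hom _ _ => (laterMap (tick (unfold τ))).app n (k.app n x)) h.symm

end Ty
end FPC

namespace FPC
open FPC.Tree FPC.Fam

/-! ### Weak bisimilarity is preserved by `θ` and by delays -/

namespace Ty

theorem bisim_one : bisim one = liftRel (eqRel Tree.one) := (congrFun bisim_eq one).symm

theorem bisim_sum (σ τ : Ty 0) : bisim (sum σ τ) = liftRel (sumRel (bisim σ) (bisim τ)) :=
  (congrFun bisim_eq (sum σ τ)).symm.trans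
    (congrArg₂ (fun R S => liftRel (sumRel R S)) (congrFun bisim_eq σ) (congrFun bisim_eq τ))

theorem bisim_prod (σ τ : Ty 0) : bisim (prod σ τ) = prodRel (bisim σ) (bisim τ) :=
  (congrFun bisim_eq (prod σ τ)).symm.trans
    (congrArg₂ (fun R S => prodRel R S) (congrFun bisim_eq σ) (congrFun bisim_eq τ))

theorem bisim_arr (σ τ : Ty 0) : bisim (arr σ τ) = expRel (bisim σ) (bisim τ) :=
  (congrFun bisim_eq (arr σ τ)).symm.trans
    (congrArg₂ (fun R S => expRel R S) (congrFun bisim_eq σ) (congrFun bisim_eq τ))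

theorem bisim_mu (τ : Ty 1) : bisim (mu τ) = reindex
      (pairHom (comp (unroll τ) (fstHom _ _)) (comp (unroll τ) (sndHom _ _)))
      (laterRel (bisim (unfold τ))) :=
  (congrFun bisim_eq (mu τ)).symm

theorem unroll_respects (τ : Ty 1) :
    Respects (bisim (mu τ)) (laterRel (bisim (unfold τ))) (unroll τ) (unroll τ) :=
  (Respects.reindex_elim _ _ _).comp (Respects.of_eq (bisim_mu τ))

/-- Relatedness at a recursive type is relatedness after unrolling. -/
theorem respects_mu {A A' : Tree} {R : Rel A A'} {τ : Ty 1} {f : Hom A (den (mu τ))}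
    {f' : Hom A' (den (mu τ))}
    (h : Respects R (laterRel (bisim (unfold τ))) (comp (unroll τ) f) (comp (unroll τ) f')) :
    Respects R (bisim (mu τ)) f f' :=
  (Respects.of_eq (bisim_mu τ).symm).comp (Respects.reindex_intro h)

theorem roll_respects (τ : Ty 1) :
    Respects (laterRel (bisim (unfold τ))) (bisim (mu τ)) (roll τ) (roll τ) :=
  respects_mu (unroll_roll τ ▸ Respects.id _)

/-- The maps `θ` respect weak bisimilarity. -/
theorem tick_respects (τ : Ty 0) : Respects (laterRel (bisim τ)) (bisim τ) (tick τ) (tick τ) := by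
  refine respects_loeb (R := fun τ => laterRel (bisim τ)) (S := bisim) (f := tick) (f' := tick)
    (fun K hK σ => ?_) τ
  induction σ using recClosed with
  | hone =>
    rw [bisim_one, tick_one]
    exact (Respects.tickLift _).comp (Respects.snd _ _)
  | hsum σ τ =>
    rw [bisim_sum, tick_sum]
    exact (Respects.tickLift _).comp (Respects.snd _ _)
  | hprod σ τ ihσ ihτ =>
    rw [bisim_prod, tick_prod]
    exact (ihσ.comp ((Respects.fst _ _).pair ((Respects.fst _ _).laterMap.comp
      (Respects.snd _ _)))).pair
      (ihτ.comp ((Respects.fst _ _).pair ((Respects.snd _ _).laterMap.comp (Respects.snd _ _))))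
  | harr σ τ _ ihτ =>
    rw [bisim_arr, tick_arr]
    have h := (ihτ.comp (((Respects.fst K _).comp (Respects.fst _ (bisim σ))).pair
      ((Respects.laterApp (bisim σ) (bisim τ)).comp (((Respects.snd K _).comp
        (Respects.fst _ _)).pair ((Respects.next _).comp (Respects.snd _ _)))))).curry
    exact (comp_curry _ (sndHom Tree.one _)).symm ▸ h
  | hmu τ =>
    refine respects_mu ?_
    have h := (hK (unfold τ)).comp ((Respects.fst _ _).pair
      ((unroll_respects τ).laterMap.comp (Respects.snd _ _)))
    have e : comp (unroll τ) (tick (mu τ)) =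
        comp (laterMap (tick (unfold τ))) (laterMap (unroll τ)) := by
      rw [tick_mu]
      exact congrArg (fun k => comp k (comp (laterMap (tick (unfold τ))) (laterMap (unroll τ))))
        (unroll_roll τ)
    change Respects _ _ (comp (comp (unroll τ) (tick (mu τ))) (sndHom _ _))
      (comp (comp (unroll τ) (tick (mu τ))) (sndHom _ _))
    rw [e]
    exact h

/-- The type constructors act on the endomorphisms `g τ` as they act on delays: this holds both
for `g = δ` and for the identity. -/
structure Structural (g : ∀ τ : Ty 0, Hom (den τ) (den τ)) : Prop where
  map_prod σ τ : g (prod σ τ) = pairHom (comp (g σ) (fstHom _ _)) (comp (g τ) (sndHom _ _))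
  map_arr σ τ : g (arr σ τ) = curry (comp (g τ) (evalHom _ _))
  unroll_comp τ : comp (unroll τ) (g (mu τ)) = comp (laterMap (g (unfold τ))) (unroll τ)

theorem structural_id : Structural (fun τ => idHom (den τ)) where
  map_prod _ _ := rfl
  map_arr _ _ := curry_eval.symm
  unroll_comp τ := by rw [laterMap_id]; rfl

theorem structural_delay : Structural delay := ⟨delay_prod, delay_arr, unroll_delay_mu⟩

/-- If structural families respect `≈` at the types that are interpreted by the lifting monad, then
they respect `≈` at all types. -/
theorem Structural.respects {g g' : ∀ τ : Ty 0, Hom (den τ) (den τ)} (hg : Structural g)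
    (hg' : Structural g') (hone : Respects (bisim one) (bisim one) (g one) (g' one))
    (hsum : ∀ σ τ, Respects (bisim (sum σ τ)) (bisim (sum σ τ)) (g (sum σ τ)) (g' (sum σ τ)))
    (τ : Ty 0) : Respects (bisim τ) (bisim τ) (g τ) (g' τ) := by
  refine respects_loeb (R := bisim) (S := bisim) (f := g) (f' := g') (fun K hK σ => ?_) τ
  induction σ using recClosed with
  | hone => exact hone.comp (Respects.snd _ _)
  | hsum σ τ => exact (hsum σ τ).comp (Respects.snd _ _)
  | hprod σ τ ihσ ihτ =>
    rw [bisim_prod, hg.map_prod, hg'.map_prod]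
    exact (ihσ.comp ((Respects.fst _ _).pair ((Respects.fst _ _).comp (Respects.snd _ _)))).pair
      (ihτ.comp ((Respects.fst _ _).pair ((Respects.snd _ _).comp (Respects.snd _ _))))
  | harr σ τ _ ihτ =>
    rw [bisim_arr, hg.map_arr, hg'.map_arr]
    have h := (ihτ.comp (((Respects.fst K _).comp (Respects.fst _ (bisim σ))).pair
      ((Respects.eval (bisim σ) (bisim τ)).comp (((Respects.snd K _).comp
        (Respects.fst _ _)).pair (Respects.snd _ _))))).curry
    exact (comp_curry (comp (g τ) (evalHom _ _)) (sndHom Tree.one _)).symm ▸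
      (comp_curry (comp (g' τ) (evalHom _ _)) (sndHom Tree.one _)).symm ▸ h
  | hmu τ =>
    refine respects_mu ?_
    change Respects _ _ (comp (comp (unroll τ) (g (mu τ))) (sndHom _ _))
      (comp (comp (unroll τ) (g' (mu τ))) (sndHom _ _))
    rw [hg.unroll_comp, hg'.unroll_comp]
    exact (hK (unfold τ)).comp ((Respects.fst _ _).pair ((unroll_respects τ).comp
      (Respects.snd _ _)))

end Ty
end FPC

namespace FPC
open FPC.Tree FPC.Fam

/-! ### Delays and extensions on the lifting monad -/

namespace Tree

theorem delayLift_app (A : Tree) (n : ℕ) (x : (lift A).obj n) :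
    (delayLift A).app n x = Sum.inr (liftTailRes A n x) := by
  cases n <;> rfl

/-- The morphism `δ` on `L A` in a form uniform in the stage. -/
theorem delayLift_eq (A : Tree) :
    delayLift A = ⟨fun n x => Sum.inr (liftTailRes A n x), fun _ _ => rfl⟩ := by
  ext n x
  exact delayLift_app A n x

theorem eq_of_inl_eq_iterate {A : Tree} {n m : ℕ} {a b : A.obj n}
    (h : (Sum.inl a : (lift A).obj n) = ((delayLift A).app n)^[m] ((now A).app n b)) : b = a := by
  cases m with
  | zero => exact (Sum.inl.inj h).symm
  | succ m =>
    rw [Function.iterate_succ_apply', delayLift_app] at h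
    exact nomatch h

theorem eq_iterate_of_inr_eq {A : Tree} {n m : ℕ} {x : (lift A).obj n} {a : A.obj (n + 1)}
    (h : (Sum.inr x : (lift A).obj (n + 1)) =
      ((delayLift A).app (n + 1))^[m] ((now A).app (n + 1) a)) :
    x = ((delayLift A).app n)^[m - 1] ((now A).app n (A.res n a)) := by
  cases m with
  | zero => exact nomatch h
  | succ m =>
    rw [Function.iterate_succ_apply', delayLift_app] at h
    exact (Sum.inr.inj h).trans (delay_res n m _)

/-- Iteration of an endomorphism. -/
def iterate {A : Tree} (f : Hom A A) (m : ℕ) : Hom A A :=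
  ⟨fun n => (f.app n)^[m], fun n a =>
    Function.Semiconj.iterate_right (f := A.res n) (fun a => f.nat n a) m a⟩

theorem extend_inl {C A B : Tree} (θ : Hom (later B) B) (f : Hom (prod C A) B) (n : ℕ)
    (c : C.obj n) (a : A.obj n) : (extend θ f).app n (c, Sum.inl a) = f.app n (c, a) := by
  cases n <;> rfl

theorem extend_delayLift {C A B : Tree} (θ : Hom (later B) B) (f : Hom (prod C A) B) (n : ℕ)
    (c : C.obj n) (x : (lift A).obj n) :
    (extend θ f).app n (c, (delayLift A).app n x) =
      (comp θ (next B)).app n ((extend θ f).app n (c, x)) := by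
  cases n with
  | zero => rfl
  | succ n => exact congrArg (θ.app (n + 1)) ((extend θ f).nat n (c, x)).symm

theorem extend_iterate {C A B : Tree} (θ : Hom (later B) B) (f : Hom (prod C A) B) (n m : ℕ)
    (c : C.obj n) (x : (lift A).obj n) :
    (extend θ f).app n (c, ((delayLift A).app n)^[m] x) =
      ((comp θ (next B)).app n)^[m] ((extend θ f).app n (c, x)) :=
  Function.Semiconj.iterate_right (f := fun x => (extend θ f).app n (c, x))
    (fun x => extend_delayLift θ f n c x) m x

theorem extend_eq_iterate {C A B : Tree} (θ : Hom (later B) B) (f : Hom (prod C A) B) {n m : ℕ}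
    (c : C.obj n) {x : (lift A).obj n} {a : A.obj n}
    (h : x = ((delayLift A).app n)^[m] ((now A).app n a)) :
    ((comp θ (next B)).app n)^[m] (f.app n (c, a)) = (extend θ f).app n (c, x) := by
  subst h
  rw [← extend_inl θ f]
  exact (extend_iterate θ f n m c (Sum.inl a)).symm

end Tree

namespace Fam

variable {A B : Tree}

/-- If `θ x` terminates after `m` steps, then `x` terminates after `m - 1` steps. -/
def Ends.pred {n : ℕ} {Q₁ : A.obj (n + 1) → Type} {Q : A.obj n → Type}
    (f : ∀ a, Q₁ a → Q (A.res n a)) {x : (lift A).obj n}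
    (e : Ends (n + 1) Q₁ (Sum.inr x : (lift A).obj (n + 1))) : Ends n Q x :=
  ⟨e.1 - 1, A.res n e.2.1, ⟨eq_iterate_of_inr_eq e.2.2.1.down⟩, f _ e.2.2.2⟩

/-- Delaying a terminating computation. -/
def Ends.delay {n : ℕ} {Q : A.obj n → Type} {x : (lift A).obj n} (e : Ends n Q x) :
    Ends n Q (Sum.inr (liftTailRes A n x) : (lift A).obj n) :=
  ⟨e.1 + 1, e.2.1, ⟨by
    rw [Function.iterate_succ_apply', ← e.2.2.1.down, delayLift_app]⟩, e.2.2.2⟩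

/-- A value is related to the computations that terminate in related values. -/
def relOfEndsRight (R : Rel A B) (n : ℕ) (a : A.obj n) :
    ∀ y : (lift B).obj n, Ends n (fun b => R.obj n (a, b)) y →
      liftRelStep n (R.obj n) (liftRelTail R n) (Sum.inl a) y
  | Sum.inl _, e => cast (congrArg (fun b => R.obj n (a, b)) (eq_of_inl_eq_iterate e.2.2.1.down))
      e.2.2.2
  | Sum.inr _, e => e

theorem relOfEndsRight_res (R : Rel A B) (n : ℕ) (a : A.obj (n + 1)) (y : (lift B).obj (n + 1))
    (e : Ends (n + 1) (fun b => R.obj (n + 1) (a, b)) y) :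
    liftRelStepRes (fun p => R.res n p _ rfl) (liftRelTailRes R n) (Sum.inl a) y
      (relOfEndsRight R (n + 1) a y e) =
    relOfEndsRight R n (A.res n a) ((lift B).res n y)
      (e.res (fun b => R.res n (a, b) _ rfl)) := by
  obtain b | y := y
  · obtain ⟨m, b', ⟨h⟩, r⟩ := e
    obtain rfl := eq_of_inl_eq_iterate h
    rfl
  · rfl

/-- Computations that terminate in values related to a given value are related to it. -/
def relOfEndsLeft (R : Rel A B) (n : ℕ) (b : B.obj n) :
    ∀ x : (lift A).obj n, Ends n (fun a => R.obj n (a, b)) x →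
      liftRelStep n (R.obj n) (liftRelTail R n) x (Sum.inl b)
  | Sum.inl _, e => cast (congrArg (fun a => R.obj n (a, b)) (eq_of_inl_eq_iterate e.2.2.1.down))
      e.2.2.2
  | Sum.inr _, e => e

theorem relOfEndsLeft_res (R : Rel A B) (n : ℕ) (b : B.obj (n + 1)) (x : (lift A).obj (n + 1))
    (e : Ends (n + 1) (fun a => R.obj (n + 1) (a, b)) x) :
    liftRelStepRes (fun p => R.res n p _ rfl) (liftRelTailRes R n) x (Sum.inl b)
      (relOfEndsLeft R (n + 1) b x e) =
    relOfEndsLeft R n (B.res n b) ((lift A).res n x)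
      (e.res (fun a => R.res n (a, b) _ rfl)) := by
  obtain a | x := x
  · obtain ⟨m, a', ⟨h⟩, r⟩ := e
    obtain rfl := eq_of_inl_eq_iterate h
    rfl
  · rfl

/-- If `x (L R) y`, then `x (L R) δ y`. -/
def liftRelDelayRight (R : Rel A B) : ∀ (n : ℕ) (x : (lift A).obj n) (y : (lift B).obj n),
    liftRelStep n (R.obj n) (liftRelTail R n) x y →
      liftRelStep n (R.obj n) (liftRelTail R n) x (Sum.inr (liftTailRes B n y))
  | _, Sum.inl _, Sum.inl b, e => Ends.delay (x := Sum.inl b) ⟨0, b, ⟨rfl⟩, e⟩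
  | _, Sum.inl _, Sum.inr y, e => Ends.delay (x := Sum.inr y) e
  | 0, Sum.inr _, _, _ => PUnit.unit
  | n + 1, Sum.inr x, Sum.inl b, e => relOfEndsLeft R n (B.res n b) x
      (Ends.pred (fun a => R.res n (a, b) _ rfl) e)
  | n + 1, Sum.inr x, Sum.inr y, e => liftRelDelayRight R n x y e

/-- If `x (L R) y`, then `δ x (L R) y`. -/
def liftRelDelayLeft (R : Rel A B) : ∀ (n : ℕ) (x : (lift A).obj n) (y : (lift B).obj n),
    liftRelStep n (R.obj n) (liftRelTail R n) x y →
      liftRelStep n (R.obj n) (liftRelTail R n) (Sum.inr (liftTailRes A n x)) y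
  | _, Sum.inl a, Sum.inl _, e => Ends.delay (x := Sum.inl a) ⟨0, a, ⟨rfl⟩, e⟩
  | _, Sum.inr x, Sum.inl _, e => Ends.delay (x := Sum.inr x) e
  | 0, _, Sum.inr _, _ => PUnit.unit
  | n + 1, Sum.inl a, Sum.inr y, e => relOfEndsRight R n (A.res n a) y
      (Ends.pred (fun b => R.res n (a, b) _ rfl) e)
  | n + 1, Sum.inr x, Sum.inr y, e => liftRelDelayLeft R n x y e

theorem liftRelDelayRight_res (R : Rel A B) (n : ℕ) (x : (lift A).obj (n + 1))
    (y : (lift B).obj (n + 1)) (e : liftRelStep (n + 1) (R.obj _) (liftRelTail R _) x y) :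
    liftRelStepRes (fun p => R.res n p _ rfl) (liftRelTailRes R n) x
      (Sum.inr (liftTailRes B (n + 1) y)) (liftRelDelayRight R (n + 1) x y e) =
    liftRelDelayRight R n ((lift A).res n x) ((lift B).res n y)
      (liftRelStepRes (fun p => R.res n p _ rfl) (liftRelTailRes R n) x y e) := by
  induction n with
  | zero => obtain a | x := x <;> obtain b | y := y <;> rfl
  | succ n ih =>
    obtain a | x := x <;> obtain b | y := y
    · rfl
    · rfl
    · exact relOfEndsLeft_res R n (B.res (n + 1) b) x _
    · exact ih x y e

theorem liftRelDelayLeft_res (R : Rel A B) (n : ℕ) (x : (lift A).obj (n + 1))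
    (y : (lift B).obj (n + 1)) (e : liftRelStep (n + 1) (R.obj _) (liftRelTail R _) x y) :
    liftRelStepRes (fun p => R.res n p _ rfl) (liftRelTailRes R n)
      (Sum.inr (liftTailRes A (n + 1) x)) y (liftRelDelayLeft R (n + 1) x y e) =
    liftRelDelayLeft R n ((lift A).res n x) ((lift B).res n y)
      (liftRelStepRes (fun p => R.res n p _ rfl) (liftRelTailRes R n) x y e) := by
  induction n with
  | zero => obtain a | x := x <;> obtain b | y := y <;> rfl
  | succ n ih =>
    obtain a | x := x <;> obtain b | y := y
    · rfl
    · exact relOfEndsRight_res R n (A.res (n + 1) a) y _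
    · rfl
    · exact ih x y e

theorem Respects.delayLift_right (R : Rel A B) :
    Respects (liftRel R) (liftRel R) (idHom _) (delayLift B) := by
  rw [delayLift_eq]
  refine ⟨fun n q e => liftRelDelayRight R n q.1 q.2 e, fun n q q' h e => ?_⟩
  subst h
  exact liftRelDelayRight_res R n q.1 q.2 e

theorem Respects.delayLift_left (R : Rel A B) :
    Respects (liftRel R) (liftRel R) (delayLift A) (idHom _) := by
  rw [delayLift_eq]
  refine ⟨fun n q e => liftRelDelayLeft R n q.1 q.2 e, fun n q q' h e => ?_⟩
  subst h
  exact liftRelDelayLeft_res R n q.1 q.2 e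

theorem Respects.iterate {R : Rel A B} {f : Hom A A} {f' : Hom B B} (h : Respects R R f f')
    (m : ℕ) : Respects R R (Tree.iterate f m) (Tree.iterate f' m) := by
  induction m with
  | zero => exact Respects.id R
  | succ m ih => exact ih.comp h

theorem iterate_id (A : Tree) (m : ℕ) : Tree.iterate (idHom A) m = idHom A := by
  ext n a
  exact congrFun (Function.iterate_id m) a

/-- Transport along equalities in the base commutes with restriction. -/
theorem res_cast_eq {B : Tree} (R : Fam B) {n : ℕ} {b b₁ : B.obj (n + 1)} {b' b₁' : B.obj n}
    (h : b = b₁) (h' : b' = b₁') {hb : B.res n b = b'} {hb₁ : B.res n b₁ = b₁'}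
    {e : R.obj (n + 1) b} {e' : R.obj n b'} (he : R.res n b b' hb e = e') :
    R.res n b₁ b₁' hb₁ (cast (congrArg (R.obj (n + 1)) h) e) =
      cast (congrArg (R.obj n) h') e' := by
  subst h h' he; rfl

/-- Extensions to the lifting monad respect `L R`, provided that the relation on the codomain is
preserved by the algebra structure and by delays on either side. The last two conditions deal with
a value that is compared with a delayed value. -/
theorem Respects.extend {C C' D D' : Tree} {K : Rel C C'} {R : Rel A B} {S : Rel D D'}
    {θ : Hom (later D) D} {θ' : Hom (later D') D'} {f : Hom (Tree.prod C A) D}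
    {f' : Hom (Tree.prod C' B) D'} (hθ : Respects (laterRel S) S θ θ')
    (hr : Respects S S (idHom _) (Tree.comp θ' (Tree.next D')))
    (hl : Respects S S (Tree.comp θ (Tree.next D)) (idHom _))
    (hf : Respects (prodRel K R) S f f') :
    Respects (prodRel K (liftRel R)) S (Tree.extend θ f) (Tree.extend θ' f') := by
  obtain ⟨t, ht⟩ := hθ
  obtain ⟨φ, hφ⟩ := hf
  -- Delays by any number of steps on one side preserve `S`.
  have hr' := fun m => iterate_id D m ▸ hr.iterate m
  have hl' := fun m => iterate_id D' m ▸ hl.iterate m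
  choose ρ hρ using hr'
  choose μ hμ using hl'
  refine respects_loeb (I := Unit) (R := fun _ => prodRel K (liftRel R)) (S := fun _ => S)
    (f := fun _ => Tree.extend θ f) (f' := fun _ => Tree.extend θ' f') (fun G hG _ => ?_) ()
  obtain ⟨ψ, hψ⟩ := hG ()
  let E := Tree.extend θ f
  let E' := Tree.extend θ' f'
  let Φ : ∀ n c c' x y, G.obj n (PUnit.unit, PUnit.unit) → K.obj n (c, c') →
      liftRelStep n (R.obj n) (liftRelTail R n) x y → S.obj n (E.app n (c, x), E'.app n (c', y)) :=
    fun n c c' x y g k => match n, x, y with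
    | n, Sum.inl a, Sum.inl b => fun e =>
        cast (congrArg (S.obj n)
          (Prod.ext (extend_inl θ f n c a).symm (extend_inl θ' f' n c' b).symm))
          (φ n ((c, a), (c', b)) (k, e))
    -- A value faces a computation that takes `e.1` steps, so the witness for the two values is
    -- delayed as many times on that side.
    | n, Sum.inl a, Sum.inr _ => fun e =>
        cast (congrArg (S.obj n)
          (Prod.ext (extend_inl θ f n c a).symm (extend_eq_iterate θ' f' c' e.2.2.1.down)))
          (ρ e.1 n _ (φ n ((c, a), (c', e.2.1)) (k, e.2.2.2)))
    | n, Sum.inr _, Sum.inl b => fun e =>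
        cast (congrArg (S.obj n)
          (Prod.ext (extend_eq_iterate θ f c e.2.2.1.down) (extend_inl θ' f' n c' b).symm))
          (μ e.1 n _ (φ n ((c, e.2.1), (c', b)) (k, e.2.2.2)))
    | 0, Sum.inr x, Sum.inr y => fun e => t 0 (PUnit.unit, PUnit.unit) PUnit.unit
    | n + 1, Sum.inr x, Sum.inr y => fun e =>
        t (n + 1) _ (ψ (n + 1) ((PUnit.unit, (C.res n c, x)), (PUnit.unit, (C'.res n c', y)))
          (g, (K.res n (c, c') _ rfl k, e)))
  refine ⟨fun n q e => Φ n q.1.2.1 q.2.2.1 q.1.2.2 q.2.2.2 e.1 e.2.1 e.2.2, fun n q q' h e => ?_⟩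
  subst h
  obtain ⟨⟨u, c, x⟩, ⟨u', c', y⟩⟩ := q
  obtain ⟨g, k, e⟩ := e
  obtain a | x := x <;> obtain b | y := y
  · exact res_cast_eq S
      (Prod.ext (extend_inl θ f _ c a).symm (extend_inl θ' f' _ c' b).symm)
      (Prod.ext (extend_inl θ f n (C.res n c) (A.res n a)).symm
        (extend_inl θ' f' n (C'.res n c') (B.res n b)).symm)
      (hφ n ((c, a), (c', b)) _ rfl (k, e))
  · have h := (e.res (Q := fun b => R.obj n (A.res n a, b))
      (fun b => R.res n (a, b) _ rfl)).2.2.1.down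
    exact res_cast_eq S
      (Prod.ext (extend_inl θ f _ c a).symm (extend_eq_iterate θ' f' c' e.2.2.1.down))
      (Prod.ext (extend_inl θ f n (C.res n c) (A.res n a)).symm
        (extend_eq_iterate θ' f' (C'.res n c') h))
      ((hρ e.1 n _ _ (app_res_eq f f' rfl) _).trans
        (congrArg (ρ e.1 n _) (hφ n ((c, a), (c', e.2.1)) _ rfl (k, e.2.2.2))))
  · have h := (e.res (Q := fun a => R.obj n (a, B.res n b))
      (fun a => R.res n (a, b) _ rfl)).2.2.1.down
    exact res_cast_eq S
      (Prod.ext (extend_eq_iterate θ f c e.2.2.1.down) (extend_inl θ' f' _ c' b).symm)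
      (Prod.ext (extend_eq_iterate θ f (C.res n c) h)
        (extend_inl θ' f' n (C'.res n c') (B.res n b)).symm)
      ((hμ e.1 n _ _ (app_res_eq f f' rfl) _).trans
        (congrArg (μ e.1 n _) (hφ n ((c, e.2.1), (c', b)) _ rfl (k, e.2.2.2))))
  · cases n with
    | zero => exact ht 0 (E.app 0 (C.res 0 c, x), E'.app 0 (C'.res 0 c', y)) _ rfl _
    | succ n =>
      exact (ht (n + 1) (E.app (n + 1) (C.res (n + 1) c, x), E'.app (n + 1) (C'.res (n + 1) c', y))
        _ (app_res_eq E E' (q := ((C.res (n + 1) c, x), (C'.res (n + 1) c', y))) rfl) _).trans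
        (congrArg (t (n + 1) _)
          (hψ (n + 1) ((PUnit.unit, (C.res (n + 1) c, x)), (PUnit.unit, (C'.res (n + 1) c', y))) _
            rfl (g, (K.res (n + 1) (c, c') _ rfl k, e))))

end Fam
end FPC

namespace FPC
open FPC.Tree FPC.Fam

/-! ### Weak bisimilarity is a congruence -/

namespace Ty

theorem delay_respects_right (τ : Ty 0) :
    Respects (bisim τ) (bisim τ) (idHom (den τ)) (delay τ) := by
  refine structural_id.respects structural_delay ?_ (fun σ τ => ?_) τ
  · rw [bisim_one, delay_one]
    exact Respects.delayLift_right _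
  · rw [bisim_sum, delay_sum]
    exact Respects.delayLift_right _

theorem delay_respects_left (τ : Ty 0) :
    Respects (bisim τ) (bisim τ) (delay τ) (idHom (den τ)) := by
  refine structural_delay.respects structural_id ?_ (fun σ τ => ?_) τ
  · rw [bisim_one, delay_one]
    exact Respects.delayLift_left _
  · rw [bisim_sum, delay_sum]
    exact Respects.delayLift_left _

end Ty

open Ty

/-- The type `d ≈_{Γ,τ} d'` on derivations has a global element. -/
abbrev Bisimilar {Γ : List (Ty 0)} {M M' : Tm} {τ : Ty 0} (d : HasType Γ M τ)
    (d' : HasType Γ M' τ) : Prop :=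
  Respects (bisimCtx Γ) (bisim τ) d.den d'.den

namespace Bisimilar

variable {Γ : List (Ty 0)} {σ τ ρ : Ty 0} {L L' M M' N N' : Tm}

theorem lookup {i : ℕ} (x : Lookup Γ i τ) : Respects (bisimCtx Γ) (bisim τ) x.den x.den := by
  induction x with
  | zero => exact Respects.snd _ _
  | succ x ih => exact ih.comp (Respects.fst _ _)

theorem lam {d : HasType (σ :: Γ) M τ} {d' : HasType (σ :: Γ) M' τ} (h : Bisimilar d d') :
    Bisimilar d.lam d'.lam := by
  unfold Bisimilar
  rw [bisim_arr]
  exact Respects.curry h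

theorem app {d : HasType Γ M (.arr σ τ)} {d' : HasType Γ M' (.arr σ τ)} {e : HasType Γ N σ}
    {e' : HasType Γ N' σ} (hd : Bisimilar d d') (he : Bisimilar e e') :
    Bisimilar (d.app e) (d'.app e') := by
  unfold Bisimilar at hd
  rw [bisim_arr] at hd
  exact (Respects.eval (bisim σ) (bisim τ)).comp (Respects.pair hd he)

theorem inl {d : HasType Γ M σ} {d' : HasType Γ M' σ} (h : Bisimilar d d') :
    Bisimilar (d.inl (τ₂ := τ)) (d'.inl (τ₂ := τ)) := by
  unfold Bisimilar
  rw [bisim_sum]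
  exact (Respects.now _).comp ((Respects.inl (bisim σ) (bisim τ)).comp h)

theorem inr {d : HasType Γ M τ} {d' : HasType Γ M' τ} (h : Bisimilar d d') :
    Bisimilar (d.inr (τ₁ := σ)) (d'.inr (τ₁ := σ)) := by
  unfold Bisimilar
  rw [bisim_sum]
  exact (Respects.now _).comp ((Respects.inr (bisim σ) (bisim τ)).comp h)

theorem case {d : HasType Γ L (.sum σ τ)} {d' : HasType Γ L' (.sum σ τ)}
    {e : HasType (σ :: Γ) M ρ} {e' : HasType (σ :: Γ) M' ρ}
    {f : HasType (τ :: Γ) N ρ} {f' : HasType (τ :: Γ) N' ρ}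
    (hd : Bisimilar d d') (he : Bisimilar e e') (hf : Bisimilar f f') :
    Bisimilar (d.case e f) (d'.case e' f') := by
  unfold Bisimilar at hd
  rw [bisim_sum] at hd
  exact (Respects.extend (tick_respects ρ) (delay_respects_right ρ) (delay_respects_left ρ)
    (Respects.caseHom (K := bisimCtx Γ) he hf)).comp ((Respects.id _).pair hd)

theorem fst {d : HasType Γ M (.prod σ τ)} {d' : HasType Γ M' (.prod σ τ)}
    (h : Bisimilar d d') : Bisimilar d.fst d'.fst := by
  unfold Bisimilar at h
  rw [bisim_prod] at h
  exact (Respects.fst (bisim σ) (bisim τ)).comp h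

theorem snd {d : HasType Γ M (.prod σ τ)} {d' : HasType Γ M' (.prod σ τ)}
    (h : Bisimilar d d') : Bisimilar d.snd d'.snd := by
  unfold Bisimilar at h
  rw [bisim_prod] at h
  exact (Respects.snd (bisim σ) (bisim τ)).comp h

theorem pair {d : HasType Γ M σ} {d' : HasType Γ M' σ} {e : HasType Γ N τ}
    {e' : HasType Γ N' τ} (hd : Bisimilar d d') (he : Bisimilar e e') :
    Bisimilar (d.pair e) (d'.pair e') := by
  unfold Bisimilar
  rw [bisim_prod]
  exact Respects.pair hd he

theorem unfold {τ : Ty 1} {d : HasType Γ M (.mu τ)} {d' : HasType Γ M' (.mu τ)}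
    (h : Bisimilar d d') : Bisimilar d.unfold d'.unfold :=
  (tick_respects _).comp ((unroll_respects τ).comp h)

theorem fold {τ : Ty 1} {d : HasType Γ M τ.unfold} {d' : HasType Γ M' τ.unfold}
    (h : Bisimilar d d') : Bisimilar d.fold d'.fold :=
  (roll_respects τ).comp ((Respects.next _).comp h)

theorem refl (d : HasType Γ M τ) : Bisimilar d d := by
  induction d with
  | var x => exact lookup x
  | unit =>
    unfold Bisimilar
    rw [bisim_one]
    refine (Respects.now _).comp ⟨fun _ _ _ => ⟨rfl⟩, fun n q q' h e => ?_⟩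
    rfl
  | lam d ih => exact ih.lam
  | app d e ihd ihe => exact ihd.app ihe
  | inl d ih => exact ih.inl
  | inr d ih => exact ih.inr
  | case d e f ihd ihe ihf => exact ihd.case ihe ihf
  | fst d ih => exact ih.fst
  | snd d ih => exact ih.snd
  | pair d e ihd ihe => exact ihd.pair ihe
  | unfold d ih => exact ih.unfold
  | fold d ih => exact ih.fold

/-- Contexts preserve weak bisimilarity. -/
theorem fill {Δ : List (Ty 0)} {C : Cxt} (hC : CxtType Γ τ C Δ σ) {d : HasType Γ M τ}
    {d' : HasType Γ M' τ} (h : Bisimilar d d') :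
    ∃ (e : HasType Δ (C.fill M) σ) (e' : HasType Δ (C.fill M') σ), Bisimilar e e' := by
  induction hC with
  | hole => exact ⟨d, d', h⟩
  | lam _ ih => obtain ⟨e, e', he⟩ := ih; exact ⟨_, _, he.lam⟩
  | appL _ f ih => obtain ⟨e, e', he⟩ := ih; exact ⟨_, _, he.app (refl f)⟩
  | appR _ f ih => obtain ⟨e, e', he⟩ := ih; exact ⟨_, _, (refl f).app he⟩
  | unfold _ ih => obtain ⟨e, e', he⟩ := ih; exact ⟨_, _, he.unfold⟩
  | fold _ ih => obtain ⟨e, e', he⟩ := ih; exact ⟨_, _, he.fold⟩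
  | fst _ ih => obtain ⟨e, e', he⟩ := ih; exact ⟨_, _, he.fst⟩
  | snd _ ih => obtain ⟨e, e', he⟩ := ih; exact ⟨_, _, he.snd⟩
  | pairL _ f ih => obtain ⟨e, e', he⟩ := ih; exact ⟨_, _, he.pair (refl f)⟩
  | pairR _ f ih => obtain ⟨e, e', he⟩ := ih; exact ⟨_, _, (refl f).pair he⟩
  | case _ f g ih => obtain ⟨e, e', he⟩ := ih; exact ⟨_, _, he.case (refl f) (refl g)⟩
  | caseL f _ g ih => obtain ⟨e, e', he⟩ := ih; exact ⟨_, _, (refl f).case he (refl g)⟩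
  | caseR f g _ ih => obtain ⟨e, e', he⟩ := ih; exact ⟨_, _, (refl f).case (refl g) he⟩
  | inl _ ih => obtain ⟨e, e', he⟩ := ih; exact ⟨_, _, he.inl⟩
  | inr _ ih => obtain ⟨e, e', he⟩ := ih; exact ⟨_, _, he.inr⟩

/-- A global element of `x ≈_{Γ,τ} y` between global denotations is a natural family of
witnesses. -/
theorem of_global {d : HasType Γ M τ} {d' : HasType Γ M' τ}
    (h : Nonempty (BisimGlobal Γ τ d.denGlobal d'.denGlobal)) : Bisimilar d d' := by
  obtain ⟨e, he⟩ := h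
  refine ⟨fun n q r => (e n).1 n le_rfl q r, fun n q q' h r => ?_⟩
  subst h
  have h1 := (e (n + 1)).2 n le_rfl q r
  have h2 := congrArg (fun z => z.1 n le_rfl ((denCtx Γ).res n q.1, (denCtx Γ).res n q.2)
    ((bisimCtx Γ).res n q _ rfl r)) (he n)
  exact h1.trans h2

end Bisimilar

/-! ### Termination is invariant under weak bisimilarity -/

/-- The outcome of a computation at stage `n`: the value that it returns, if it does so within the
`n` available steps, together with the stage that is left. -/
def Tree.result {A : Tree} : ∀ n, (lift A).obj n → Option (Σ i, A.obj i)
  | n, Sum.inl a => some ⟨n, a⟩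
  | 0, Sum.inr _ => none
  | n + 1, Sum.inr r => Tree.result n r

theorem Tree.result_inl {A : Tree} (n : ℕ) (a : A.obj n) :
    result n (Sum.inl a : (lift A).obj n) = some ⟨n, a⟩ := by
  cases n <;> rfl

/-- A computation that takes exactly `m` steps terminates at stage `m`. -/
theorem Tree.isSome_result {A : Tree} {m k : ℕ} (hk : k = m) {x : (lift A).obj m} {a : A.obj m}
    (h : x = ((delayLift A).app m)^[k] ((now A).app m a)) : (result m x).isSome := by
  subst hk h
  induction k with
  | zero => rfl
  | succ k ih =>
    rw [Function.iterate_succ_apply', delayLift_app]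
    exact (congrArg (fun z => (result k z).isSome) (delay_res k k _)).trans ih

namespace Fam

variable {A B : Tree} {R : Rel A B}

/-- The number of steps recorded by a witness that a value is related to a delayed computation; it
is set to zero for the other witnesses. -/
def steps {n : ℕ} : ∀ {p : (Tree.prod (lift A) (lift B)).obj n}, (liftRel R).obj n p → ℕ
  | (Sum.inl _, Sum.inr _), e => e.1
  | (Sum.inl _, Sum.inl _), _ => 0
  | (Sum.inr _, _), _ => 0

theorem steps_res {n : ℕ} {p : (Tree.prod (lift A) (lift B)).obj (n + 1)}
    {p' : (Tree.prod (lift A) (lift B)).obj n} (h : (Tree.prod (lift A) (lift B)).res n p = p')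
    (e : (liftRel R).obj (n + 1) p) : steps ((liftRel R).res n p p' h e) = steps e := by
  subst h
  obtain ⟨a | x, b | y⟩ := p <;> rfl

theorem isLeft_of_res {x : ∀ n, (lift A).obj n} (hx : ∀ n, (lift A).res n (x (n + 1)) = x n)
    (m n : ℕ) (h : (x m).isLeft) : (x n).isLeft := by
  have key : ∀ n, (x n).isLeft = (x 0).isLeft := fun n => by
    induction n with
    | zero => rfl
    | succ n ih => rw [← ih, ← hx n, Sum.isLeft_map]
  rw [key, ← key m, h]

/-- If a sequence of elements that terminates is related to another sequence by compatible
witnesses, then the latter terminates too. Compatibility matters: at a fixed stage `n`, any delay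
by more than `n` steps is indistinguishable from divergence. -/
theorem exists_isSome_result (k : ℕ) (x : ∀ n, (lift A).obj n) (y : ∀ n, (lift B).obj n)
    (hx : ∀ n, (lift A).res n (x (n + 1)) = x n) (hy : ∀ n, (lift B).res n (y (n + 1)) = y n)
    (e : ∀ n, (liftRel R).obj n (x n, y n))
    (he : ∀ n, (liftRel R).res n (x (n + 1), y (n + 1)) (x n, y n) (Prod.ext (hx n) (hy n))
      (e (n + 1)) = e n) (hk : (result k (x k)).isSome) : ∃ m, (result m (y m)).isSome := by
  -- Restriction maps preserve the constructors `η` and `θ`, so each sequence is constantly one of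
  -- the two.
  by_cases hy0 : (y 0).isLeft
  · obtain ⟨b, hb⟩ := Sum.isLeft_iff.1 hy0
    exact ⟨0, by rw [hb]; rfl⟩
  have hyr : ∀ n, ∃ r, y n = Sum.inr r := fun n =>
    Sum.isRight_iff.1 (Sum.not_isLeft.1 fun h => hy0 (isLeft_of_res hy n 0 h))
  choose y' hy' using hyr
  obtain rfl : y = fun n => Sum.inr (y' n) := funext hy'
  by_cases hx0 : (x 0).isLeft
  · have hxl : ∀ n, ∃ a, x n = Sum.inl a := fun n => Sum.isLeft_iff.1 (isLeft_of_res hx 0 n hx0)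
    choose a ha using hxl
    obtain rfl : x = fun n => Sum.inl (a n) := funext ha
    -- All witnesses record the same number of steps, and at that stage the computation terminates.
    have hs : ∀ n, steps (e n) = steps (e 0) := fun n => by
      induction n with
      | zero => rfl
      | succ n ih => rw [← ih, ← he n, steps_res]
    exact ⟨steps (e 0), isSome_result (hs _) (e (steps (e 0))).2.2.1.down⟩
  · -- Both sequences are delayed; removing one step from each shifts the stages by one.
    have hxr : ∀ n, ∃ r, x n = Sum.inr r := fun n =>
      Sum.isRight_iff.1 (Sum.not_isLeft.1 fun h => hx0 (isLeft_of_res hx n 0 h))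
    choose x' hx' using hxr
    obtain rfl : x = fun n => Sum.inr (x' n) := funext hx'
    cases k with
    | zero => exact absurd hk (by simp [result])
    | succ k =>
      have key : ∀ n (u : (lift A).obj n) (v : (lift B).obj n)
          (hu : (lift A).res n (x' (n + 1 + 1)) = u) (hv : (lift B).res n (y' (n + 1 + 1)) = v),
          (liftRel R).res n (x' (n + 1 + 1), y' (n + 1 + 1)) (u, v) (Prod.ext hu hv)
            (e (n + 1 + 1)) =
          (liftRel R).res (n + 1) (Sum.inr (x' (n + 1 + 1)), Sum.inr (y' (n + 1 + 1)))
            (Sum.inr u, Sum.inr v) (Prod.ext (congrArg Sum.inr hu) (congrArg Sum.inr hv))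
            (e (n + 1 + 1)) := by
        rintro n u v rfl rfl
        rfl
      have hu : ∀ n, (lift A).res n (x' (n + 1 + 1)) = x' (n + 1) := fun n =>
        Sum.inr.inj (hx (n + 1))
      have hv : ∀ n, (lift B).res n (y' (n + 1 + 1)) = y' (n + 1) := fun n =>
        Sum.inr.inj (hy (n + 1))
      obtain ⟨m, hm⟩ := exists_isSome_result k (fun n => x' (n + 1)) (fun n => y' (n + 1)) hu hv
        (fun n => e (n + 1)) (fun n => (key n _ _ (hu n) (hv n)).trans (he (n + 1))) hk
      exact ⟨m + 1, hm⟩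

end Fam

end FPC

namespace FPC
open FPC.Tree FPC.Ty

/-! ### Soundness of the denotational semantics -/

namespace Tree

theorem extend_comp {C C' A B : Tree} (θ : Hom (later B) B) (f : Hom (prod C A) B) (g : Hom C' C)
    (n : ℕ) (c : C'.obj n) (x : (lift A).obj n) :
    (extend θ f).app n (g.app n c, x) =
      (extend θ (comp f (pairHom (comp g (fstHom _ _)) (sndHom _ _)))).app n (c, x) := by
  induction n with
  | zero => obtain a | x := x <;> rfl
  | succ n ih =>
    obtain a | x := x
    · rfl
    · refine congrArg (θ.app (n + 1)) ?_
      refine Eq.trans ?_ (ih (C'.res n c) x)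
      exact congrArg (fun z => (extend θ f).app n (z, x)) (g.nat n c)

theorem caseHom_comp {C C' A B X : Tree} (f : Hom (prod C A) X) (h : Hom (prod C B) X)
    (g : Hom C' C) :
    comp (caseHom f h) (pairHom (comp g (fstHom _ _)) (sndHom _ _)) =
      caseHom (comp f (pairHom (comp g (fstHom _ _)) (sndHom _ _)))
        (comp h (pairHom (comp g (fstHom _ _)) (sndHom _ _))) := by
  ext n ⟨c, a | b⟩ <;> rfl

end Tree

namespace HasType

variable {Γ Δ : List (Ty 0)} {L L' M M' N N' : Tm} {σ τ ρ : Ty 0} {g : Hom (denCtx Δ) (denCtx Γ)}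

/-- The denotation of `d'` is obtained from that of `d` by precomposition with `g`. -/
abbrev Over (g : Hom (denCtx Δ) (denCtx Γ)) (d : HasType Γ M τ) (d' : HasType Δ M' τ) : Prop :=
  d'.den = comp d.den g

/-- The extension of a context morphism by a variable. -/
noncomputable abbrev keep (g : Hom (denCtx Δ) (denCtx Γ)) (σ : Ty 0) :
    Hom (denCtx (σ :: Δ)) (denCtx (σ :: Γ)) :=
  pairHom (comp g (fstHom _ _)) (sndHom _ _)

namespace Over

theorem lam {d : HasType (σ :: Γ) M τ} {d' : HasType (σ :: Δ) M' τ} (h : Over (keep g σ) d d') :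
    Over g d.lam d'.lam :=
  (congrArg Tree.curry h).trans (comp_curry _ _).symm

theorem app {d : HasType Γ M (.arr σ τ)} {d' : HasType Δ M' (.arr σ τ)} {e : HasType Γ N σ}
    {e' : HasType Δ N' σ} (hd : Over g d d') (he : Over g e e') :
    Over g (d.app e) (d'.app e') :=
  congrArg₂ (fun a b => comp (evalHom σ.den τ.den) (pairHom a b)) hd he

theorem inl {d : HasType Γ M σ} {d' : HasType Δ M' σ} (h : Over g d d') :
    Over g (d.inl (τ₂ := τ)) (d'.inl (τ₂ := τ)) :=
  congrArg (fun a => comp (now _) (comp (inlHom σ.den τ.den) a)) h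

theorem inr {d : HasType Γ M τ} {d' : HasType Δ M' τ} (h : Over g d d') :
    Over g (d.inr (τ₁ := σ)) (d'.inr (τ₁ := σ)) :=
  congrArg (fun a => comp (now _) (comp (inrHom σ.den τ.den) a)) h

theorem case {d : HasType Γ L (.sum σ τ)} {d' : HasType Δ L' (.sum σ τ)}
    {e : HasType (σ :: Γ) M ρ} {e' : HasType (σ :: Δ) M' ρ}
    {f : HasType (τ :: Γ) N ρ} {f' : HasType (τ :: Δ) N' ρ}
    (hd : Over g d d') (he : Over (keep g σ) e e') (hf : Over (keep g τ) f f') :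
    Over g (d.case e f) (d'.case e' f') := by
  ext n c
  refine Eq.trans ?_ (extend_comp ρ.tick (caseHom e.den f.den) g n c _).symm
  refine congrArg₂ (fun (k : Hom _ _) x => (extend ρ.tick k).app n (c, x)) ?_
    (congrArg (fun k : Hom _ _ => k.app n c) hd)
  exact (congrArg₂ caseHom he hf).trans (caseHom_comp e.den f.den g).symm

theorem fst {d : HasType Γ M (.prod σ τ)} {d' : HasType Δ M' (.prod σ τ)} (h : Over g d d') :
    Over g d.fst d'.fst :=
  congrArg (fun a => comp (fstHom σ.den τ.den) a) h

theorem snd {d : HasType Γ M (.prod σ τ)} {d' : HasType Δ M' (.prod σ τ)} (h : Over g d d') :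
    Over g d.snd d'.snd :=
  congrArg (fun a => comp (sndHom σ.den τ.den) a) h

theorem pair {d : HasType Γ M σ} {d' : HasType Δ M' σ} {e : HasType Γ N τ}
    {e' : HasType Δ N' τ} (hd : Over g d d') (he : Over g e e') :
    Over g (d.pair e) (d'.pair e') :=
  congrArg₂ (fun a b => pairHom a b) hd he

theorem unfold {τ : Ty 1} {d : HasType Γ M (.mu τ)} {d' : HasType Δ M' (.mu τ)}
    (h : Over g d d') : Over g d.unfold d'.unfold :=
  congrArg (fun a => comp τ.unfold.tick (comp (unroll τ) a)) h

theorem fold {τ : Ty 1} {d : HasType Γ M τ.unfold} {d' : HasType Δ M' τ.unfold}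
    (h : Over g d d') : Over g d.fold d'.fold :=
  congrArg (fun a => comp (roll τ) (comp (next _) a)) h

end Over

/-- Renamings of variables are interpreted by precomposition. -/
theorem exists_rename (d : HasType Γ M τ) : ∀ {Δ : List (Ty 0)} {r : ℕ → ℕ}
    (g : Hom (denCtx Δ) (denCtx Γ)),
    (∀ i σ (x : Lookup Γ i σ), ∃ y : Lookup Δ (r i) σ, y.den = comp x.den g) →
    ∃ d' : HasType Δ (M.rename r) τ, Over g d d' := by
  have lift : ∀ {Γ Δ : List (Ty 0)} {r : ℕ → ℕ} (g : Hom (denCtx Δ) (denCtx Γ)) (ρ : Ty 0),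
      (∀ i σ (x : Lookup Γ i σ), ∃ y : Lookup Δ (r i) σ, y.den = comp x.den g) →
      ∀ i σ (x : Lookup (ρ :: Γ) i σ), ∃ y : Lookup (ρ :: Δ) (Tm.liftRen r i) σ,
        y.den = comp x.den (keep g ρ) := by
    intro Γ Δ r g ρ hg i σ x
    cases x with
    | zero => exact ⟨.zero, rfl⟩
    | succ x =>
      obtain ⟨y, hy⟩ := hg _ _ x
      exact ⟨.succ y, congrArg (fun k => comp k (fstHom _ _)) hy⟩
  induction d with
  | var x =>
    intro Δ r g hg
    obtain ⟨y, hy⟩ := hg _ _ x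
    exact ⟨.var y, hy⟩
  | unit => exact fun g _ => ⟨.unit, rfl⟩
  | lam d ih =>
    intro Δ r g hg
    obtain ⟨d', h⟩ := ih _ (lift g _ hg)
    exact ⟨_, h.lam⟩
  | app d e ihd ihe =>
    intro Δ r g hg
    obtain ⟨d', hd⟩ := ihd g hg
    obtain ⟨e', he⟩ := ihe g hg
    exact ⟨_, hd.app he⟩
  | inl d ih => exact fun g hg => let ⟨_, h⟩ := ih g hg; ⟨_, h.inl⟩
  | inr d ih => exact fun g hg => let ⟨_, h⟩ := ih g hg; ⟨_, h.inr⟩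
  | case d e f ihd ihe ihf =>
    intro Δ r g hg
    obtain ⟨d', hd⟩ := ihd g hg
    obtain ⟨e', he⟩ := ihe _ (lift g _ hg)
    obtain ⟨f', hf⟩ := ihf _ (lift g _ hg)
    exact ⟨_, hd.case he hf⟩
  | fst d ih => exact fun g hg => let ⟨_, h⟩ := ih g hg; ⟨_, h.fst⟩
  | snd d ih => exact fun g hg => let ⟨_, h⟩ := ih g hg; ⟨_, h.snd⟩
  | pair d e ihd ihe =>
    intro Δ r g hg
    obtain ⟨d', hd⟩ := ihd g hg
    obtain ⟨e', he⟩ := ihe g hg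
    exact ⟨_, hd.pair he⟩
  | unfold d ih => exact fun g hg => let ⟨_, h⟩ := ih g hg; ⟨_, h.unfold⟩
  | fold d ih => exact fun g hg => let ⟨_, h⟩ := ih g hg; ⟨_, h.fold⟩

/-- Substitutions are interpreted by precomposition. -/
theorem exists_subst (d : HasType Γ M τ) : ∀ {Δ : List (Ty 0)} {s : ℕ → Tm}
    (g : Hom (denCtx Δ) (denCtx Γ)),
    (∀ i σ (x : Lookup Γ i σ), ∃ y : HasType Δ (s i) σ, y.den = comp x.den g) →
    ∃ d' : HasType Δ (M.subst s) τ, Over g d d' := by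
  have lift : ∀ {Γ Δ : List (Ty 0)} {s : ℕ → Tm} (g : Hom (denCtx Δ) (denCtx Γ)) (ρ : Ty 0),
      (∀ i σ (x : Lookup Γ i σ), ∃ y : HasType Δ (s i) σ, y.den = comp x.den g) →
      ∀ i σ (x : Lookup (ρ :: Γ) i σ), ∃ y : HasType (ρ :: Δ) (Tm.liftSub s i) σ,
        y.den = comp x.den (keep g ρ) := by
    intro Γ Δ s g ρ hg i σ x
    cases x with
    | zero => exact ⟨.var .zero, rfl⟩
    | succ x =>
      obtain ⟨y, hy⟩ := hg _ _ x
      obtain ⟨z, hz⟩ := y.exists_rename (Δ := ρ :: Δ) (r := Nat.succ) (fstHom _ _)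
        (fun i σ x => ⟨.succ x, rfl⟩)
      exact ⟨z, hz.trans (congrArg (fun k => comp k (fstHom _ _)) hy)⟩
  induction d with
  | var x => exact fun g hg => hg _ _ x
  | unit => exact fun g _ => ⟨.unit, rfl⟩
  | lam d ih =>
    intro Δ r g hg
    obtain ⟨d', h⟩ := ih _ (lift g _ hg)
    exact ⟨_, h.lam⟩
  | app d e ihd ihe =>
    intro Δ r g hg
    obtain ⟨d', hd⟩ := ihd g hg
    obtain ⟨e', he⟩ := ihe g hg
    exact ⟨_, hd.app he⟩
  | inl d ih => exact fun g hg => let ⟨_, h⟩ := ih g hg; ⟨_, h.inl⟩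
  | inr d ih => exact fun g hg => let ⟨_, h⟩ := ih g hg; ⟨_, h.inr⟩
  | case d e f ihd ihe ihf =>
    intro Δ r g hg
    obtain ⟨d', hd⟩ := ihd g hg
    obtain ⟨e', he⟩ := ihe _ (lift g _ hg)
    obtain ⟨f', hf⟩ := ihf _ (lift g _ hg)
    exact ⟨_, hd.case he hf⟩
  | fst d ih => exact fun g hg => let ⟨_, h⟩ := ih g hg; ⟨_, h.fst⟩
  | snd d ih => exact fun g hg => let ⟨_, h⟩ := ih g hg; ⟨_, h.snd⟩
  | pair d e ihd ihe =>
    intro Δ r g hg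
    obtain ⟨d', hd⟩ := ihd g hg
    obtain ⟨e', he⟩ := ihe g hg
    exact ⟨_, hd.pair he⟩
  | unfold d ih => exact fun g hg => let ⟨_, h⟩ := ih g hg; ⟨_, h.unfold⟩
  | fold d ih => exact fun g hg => let ⟨_, h⟩ := ih g hg; ⟨_, h.fold⟩

/-- The substitution lemma for a single variable. -/
theorem exists_inst (d : HasType (σ :: Γ) M τ) (e : HasType Γ N σ) :
    ∃ d' : HasType Γ (M.inst N) τ, d'.den = comp d.den (pairHom (idHom _) e.den) := by
  refine d.exists_subst _ fun i ρ x => ?_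
  cases x with
  | zero => exact ⟨e, rfl⟩
  | succ x => exact ⟨.var x, rfl⟩

end HasType

namespace Ty

/-- The denotation `θ ∘ unroll` of `unfold` commutes with delays. -/
theorem unfold_delay_mu (τ : Ty 1) (n : ℕ) (x : (den (mu τ)).obj n) :
    (comp (tick (unfold τ)) (unroll τ)).app n ((delay (mu τ)).app n x) =
      (delay (unfold τ)).app n ((comp (tick (unfold τ)) (unroll τ)).app n x) := by
  have h : comp (unroll τ) (delay (mu τ)) =
      comp (comp (next (den (unfold τ))) (tick (unfold τ))) (unroll τ) := by
    rw [unroll_delay_mu, next_nat, delay, laterMap_comp, laterMap_next]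
  exact congrArg (fun k : Hom _ _ => (tick (unfold τ)).app n (k.app n x)) h

theorem eval_iterate_delay {σ τ : Ty 0} {n k : ℕ} {f f' : (den (arr σ τ)).obj n}
    (h : f = ((delay (arr σ τ)).app n)^[k] f') (a : (den σ).obj n) :
    (evalHom (den σ) (den τ)).app n (f, a) =
      ((delay τ).app n)^[k] ((evalHom (den σ) (den τ)).app n (f', a)) := by
  subst h
  refine Function.Semiconj.iterate_right (f := fun f : (den (arr σ τ)).obj n =>
    (evalHom (den σ) (den τ)).app n (f, a)) (fun x => ?_) _ _
  rw [delay_arr]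
  exact congrArg (fun z : (exp (den σ) (den τ)).obj n => (delay τ).app n
    ((evalHom (den σ) (den τ)).app n (z, a))) (resLE_self _ x)

end Ty

/-- If `M ⇓ᵏ v`, then `⟦M⟧ = δᵏ ⟦v⟧`. -/
theorem Eval.den_eq {Γ : List (Ty 0)} {M v : Tm} {k : ℕ} (h : Eval M k v) :
    ∀ {τ : Ty 0} (d : HasType Γ M τ), ∃ d' : HasType Γ v τ,
      ∀ n c, d.den.app n c = ((delay τ).app n)^[k] (d'.den.app n c) := by
  induction h with
  | value h => exact fun d => ⟨d, fun _ _ => rfl⟩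
  | caseInl _ _ ihL ihM =>
    intro τ d
    cases d with
    | case d e f =>
      obtain ⟨d', hd⟩ := ihL d
      cases d' with
      | inl d' =>
        obtain ⟨g, hg⟩ := e.exists_inst d'
        obtain ⟨w, hw⟩ := ihM g
        refine ⟨w, fun n c => ?_⟩
        rw [add_comm, Function.iterate_add_apply, ← hw, hg]
        have h := hd n c
        rw [delay_sum] at h
        exact (extend_eq_iterate τ.tick (Tree.caseHom e.den f.den) c h).symm
  | caseInr _ _ ihL ihM =>
    intro τ d
    cases d with
    | case d e f =>
      obtain ⟨d', hd⟩ := ihL d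
      cases d' with
      | inr d' =>
        obtain ⟨g, hg⟩ := f.exists_inst d'
        obtain ⟨w, hw⟩ := ihM g
        refine ⟨w, fun n c => ?_⟩
        rw [add_comm, Function.iterate_add_apply, ← hw, hg]
        have h := hd n c
        rw [delay_sum] at h
        exact (extend_eq_iterate τ.tick (Tree.caseHom e.den f.den) c h).symm
  | fst _ _ ihL ihM =>
    intro τ d
    cases d with
    | fst d =>
      obtain ⟨d', hd⟩ := ihL d
      cases d' with
      | pair d' e' =>
        obtain ⟨w, hw⟩ := ihM d'
        refine ⟨w, fun n c => ?_⟩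
        rw [Function.iterate_add_apply, ← hw]
        refine (congrArg Prod.fst (hd n c)).trans ?_
        refine Function.Semiconj.iterate_right (f := Prod.fst) (fun x => ?_) _ _
        rw [delay_prod]; rfl
  | snd _ _ ihL ihM =>
    intro τ d
    cases d with
    | snd d =>
      obtain ⟨d', hd⟩ := ihL d
      cases d' with
      | pair d' e' =>
        obtain ⟨w, hw⟩ := ihM e'
        refine ⟨w, fun n c => ?_⟩
        rw [Function.iterate_add_apply, ← hw]
        refine (congrArg Prod.snd (hd n c)).trans ?_
        refine Function.Semiconj.iterate_right (f := Prod.snd) (fun x => ?_) _ _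
        rw [delay_prod]; rfl
  | app _ _ ihM ihL =>
    intro τ d
    cases d with
    | app d e =>
      obtain ⟨d', hd⟩ := ihM d
      cases d' with
      | lam d' =>
        obtain ⟨g, hg⟩ := d'.exists_inst e
        obtain ⟨w, hw⟩ := ihL g
        refine ⟨w, fun n c => ?_⟩
        rw [Function.iterate_add_apply, ← hw, hg]
        refine (eval_iterate_delay (hd n c) (e.den.app n c)).trans ?_
        refine congrArg ((delay τ).app n)^[_] ?_
        exact congrArg (fun z => d'.den.app n (z, e.den.app n c)) (resLE_self _ c)
  | unfold _ _ ihM ihN =>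
    intro τ d
    cases d with
    | @unfold _ τ _ d =>
      obtain ⟨d', hd⟩ := ihM d
      cases d' with
      | fold d' =>
        obtain ⟨w, hw⟩ := ihN d'
        refine ⟨w, fun n c => ?_⟩
        refine (congrArg ((comp (tick (Ty.unfold τ)) (unroll τ)).app n) (hd n c)).trans ?_
        refine (Function.Semiconj.iterate_right (unfold_delay_mu τ n) _ _).trans ?_
        rw [add_assoc, Function.iterate_add_apply, Function.iterate_succ_apply', ← hw]
        refine congrArg ((delay (Ty.unfold τ)).app n)^[_] ?_
        exact congrArg (fun k : Hom _ _ => (tick (Ty.unfold τ)).app n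
          (k.app n ((next _).app n (d'.den.app n c)))) (unroll_roll τ)

end FPC

namespace FPC
open FPC.Tree FPC.Ty

/-! ### Substitution in terms -/

namespace Tm

theorem rename_rename (r r' : ℕ → ℕ) (M : Tm) :
    (M.rename r).rename r' = M.rename (fun i => r' (r i)) := by
  have lift : ∀ r r' : ℕ → ℕ, (fun i => liftRen r' (liftRen r i)) =
      liftRen (fun i => r' (r i)) := fun r r' => by
    funext i; cases i <;> rfl
  induction M generalizing r r' <;> simp_all only [rename]

theorem subst_rename (r : ℕ → ℕ) (s : ℕ → Tm) (M : Tm) :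
    (M.rename r).subst s = M.subst (fun i => s (r i)) := by
  have lift : ∀ (r : ℕ → ℕ) (s : ℕ → Tm), (fun i => liftSub s (liftRen r i)) =
      liftSub (fun i => s (r i)) := fun r s => by
    funext i; cases i <;> rfl
  induction M generalizing r s <;> simp_all only [rename, subst]

theorem rename_subst (s : ℕ → Tm) (r : ℕ → ℕ) (M : Tm) :
    (M.subst s).rename r = M.subst (fun i => (s i).rename r) := by
  have lift : ∀ (s : ℕ → Tm) (r : ℕ → ℕ), (fun i => (liftSub s i).rename (liftRen r)) =
      liftSub (fun i => (s i).rename r) := fun s r => by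
    funext i
    cases i with
    | zero => rfl
    | succ i => simp only [liftSub, rename_rename]; rfl
  induction M generalizing r s <;> simp_all only [rename, subst]

theorem subst_subst (s t : ℕ → Tm) (M : Tm) :
    (M.subst s).subst t = M.subst (fun i => (s i).subst t) := by
  have lift : ∀ s t : ℕ → Tm, (fun i => (liftSub s i).subst (liftSub t)) =
      liftSub (fun i => (s i).subst t) := fun s t => by
    funext i
    cases i with
    | zero => rfl
    | succ i => simp only [liftSub, subst_rename, rename_subst]
  induction M generalizing s t <;> simp_all only [subst]

theorem subst_var (M : Tm) : M.subst var = M := by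
  have lift : liftSub var = var := by
    funext i; cases i <;> rfl
  induction M <;> simp_all only [subst]

/-- The extension of a substitution by a term for the variable with index `0`. -/
def cons (N : Tm) (s : ℕ → Tm) : ℕ → Tm
  | 0 => N
  | i + 1 => s i

/-- A substitution under a binder followed by an instantiation is a single substitution. -/
theorem inst_subst (M N : Tm) (s : ℕ → Tm) :
    (M.subst (liftSub s)).inst N = M.subst (cons N s) := by
  rw [inst, subst_subst]
  congr 1
  funext i
  cases i with
  | zero => rfl
  | succ i =>
    simp only [liftSub, subst_rename]
    exact subst_var _

/-- Every value of `M` is a value of `M'`. -/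
def Refines (M M' : Tm) : Prop := ∀ v, EvalsTo M v → EvalsTo M' v

namespace Refines

variable {L L' M M' N : Tm}

theorem fst (h : Refines M M') : Refines M.fst M'.fst := by
  rintro v ⟨_, hv⟩
  cases hv with
  | value hv => cases hv
  | fst h₁ h₂ => obtain ⟨k, hk⟩ := h _ ⟨_, h₁⟩; exact ⟨_, hk.fst h₂⟩

theorem snd (h : Refines M M') : Refines M.snd M'.snd := by
  rintro v ⟨_, hv⟩
  cases hv with
  | value hv => cases hv
  | snd h₁ h₂ => obtain ⟨k, hk⟩ := h _ ⟨_, h₁⟩; exact ⟨_, hk.snd h₂⟩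

theorem app (h : Refines M M') : Refines (M.app N) (M'.app N) := by
  rintro v ⟨_, hv⟩
  cases hv with
  | value hv => cases hv
  | app h₁ h₂ => obtain ⟨k, hk⟩ := h _ ⟨_, h₁⟩; exact ⟨_, hk.app h₂⟩

theorem unfold (h : Refines M M') : Refines M.unfold M'.unfold := by
  rintro v ⟨_, hv⟩
  cases hv with
  | value hv => cases hv
  | unfold h₁ h₂ => obtain ⟨k, hk⟩ := h _ ⟨_, h₁⟩; exact ⟨_, hk.unfold h₂⟩

theorem fst_pair : Refines M (Tm.fst (Tm.pair M N)) :=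
  fun _ ⟨_, h⟩ => ⟨_, .fst (.value (.pair M N)) h⟩

theorem snd_pair : Refines N (Tm.snd (Tm.pair M N)) :=
  fun _ ⟨_, h⟩ => ⟨_, .snd (.value (.pair M N)) h⟩

theorem beta (σ : Ty 0) : Refines (M.inst N) (.app (.lam σ M) N) :=
  fun _ ⟨_, h⟩ => ⟨_, .app (.value (.lam σ M)) h⟩

theorem unfold_fold : Refines M (.unfold (.fold M)) :=
  fun _ ⟨_, h⟩ => ⟨_, .unfold (.value (.fold M)) h⟩

theorem case_inl (h : EvalsTo L (inl L')) : Refines (M.inst L') (case L M N) :=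
  fun _ ⟨_, h'⟩ => let ⟨_, hk⟩ := h; ⟨_, .caseInl hk h'⟩

theorem case_inr (h : EvalsTo L (inr L')) : Refines (N.inst L') (case L M N) :=
  fun _ ⟨_, h'⟩ => let ⟨_, hk⟩ := h; ⟨_, .caseInr hk h'⟩

end Refines

end Tm

/-! ### Computational adequacy -/

/-- The step-indexed logical relation between denotations and terms: whatever the denotation
reveals within the available steps is matched by the evaluation of the term. The number of
evaluation steps is not recorded, and the terms need not be typed. -/
def Approx : (n : ℕ) → (τ : Ty 0) → (den τ).obj n → Tm → Prop
  | n, .one, x, M => (result (A := Tree.one) n x).isSome → EvalsTo M .unit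
  | n, .sum σ τ, x, M => ∀ i, i ≤ n →
      (∀ a : (den σ).obj i, result (A := Tree.sum (den σ) (den τ)) n x = some ⟨i, Sum.inl a⟩ →
        ∃ M', EvalsTo M (.inl M') ∧ Approx i σ a M') ∧
      (∀ b : (den τ).obj i, result (A := Tree.sum (den σ) (den τ)) n x = some ⟨i, Sum.inr b⟩ →
        ∃ M', EvalsTo M (.inr M') ∧ Approx i τ b M')
  | n, .prod σ τ, x, M => Approx n σ x.1 (.fst M) ∧ Approx n τ x.2 (.snd M)
  | n, .arr σ τ, f, M => ∀ i (h : i ≤ n) (a : (den σ).obj i) N, Approx i σ a N →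
      Approx i τ (f.1 i h a) (.app M N)
  | 0, .mu _, _, _ => True
  | n + 1, .mu τ, x, M => Approx n (Ty.unfold τ) ((unroll τ).app (n + 1) x) (.unfold M)
termination_by n τ => (n, sizeOf τ)
decreasing_by
  all_goals simp_wf
  all_goals first
    | exact Prod.Lex.left _ _ (Nat.lt_succ_self _)
    | exact Prod.Lex.right _ (by omega)
    | exact Prod.lex_def.2 ((Nat.lt_or_eq_of_le ‹_ ≤ _›).imp_right fun h => ⟨h, by omega⟩)

/-- Induction on stages and, at a fixed stage, on types. -/
theorem stage_induction {P : ℕ → Ty 0 → Prop} (one : ∀ n, P n .one)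
    (sum : ∀ n σ τ, (∀ i ≤ n, P i σ) → (∀ i ≤ n, P i τ) → P n (.sum σ τ))
    (prod : ∀ n σ τ, P n σ → P n τ → P n (.prod σ τ))
    (arr : ∀ n σ τ, (∀ i ≤ n, P i σ) → (∀ i ≤ n, P i τ) → P n (.arr σ τ))
    (mu : ∀ n τ, (∀ i < n, P i (Ty.unfold τ)) → P n (.mu τ)) (n : ℕ) (τ : Ty 0) : P n τ := by
  induction n using Nat.strong_induction_on generalizing τ with
  | _ n ih =>
    have le : ∀ τ, P n τ → ∀ i ≤ n, P i τ := fun τ h i hi => by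
      rcases hi.lt_or_eq with hi | rfl
      · exact ih i hi τ
      · exact h
    induction τ using recClosed with
    | hone => exact one n
    | hsum σ τ hσ hτ => exact sum n σ τ (le σ hσ) (le τ hτ)
    | hprod σ τ hσ hτ => exact prod n σ τ hσ hτ
    | harr σ τ hσ hτ => exact arr n σ τ (le σ hσ) (le τ hτ)
    | hmu τ => exact mu n τ fun i hi => ih i hi _

/-- The logical relation is closed under refinement of terms. This includes closure under
expansion along evaluation steps. -/
theorem Approx.mono {n : ℕ} {τ : Ty 0} {x : (den τ).obj n} {M M' : Tm} (h : Approx n τ x M)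
    (hM : Tm.Refines M M') : Approx n τ x M' := by
  induction n, τ using stage_induction generalizing M M' with
  | one n =>
    rw [Approx] at h ⊢
    exact fun hx => hM _ (h hx)
  | sum n σ τ ihσ ihτ =>
    rw [Approx] at h ⊢
    intro i hi
    refine ⟨fun a ha => ?_, fun b hb => ?_⟩
    · obtain ⟨L, hL, h'⟩ := (h i hi).1 a ha
      exact ⟨L, hM _ hL, h'⟩
    · obtain ⟨L, hL, h'⟩ := (h i hi).2 b hb
      exact ⟨L, hM _ hL, h'⟩
  | prod n σ τ ihσ ihτ =>
    rw [Approx] at h ⊢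
    exact ⟨ihσ h.1 hM.fst, ihτ h.2 hM.snd⟩
  | arr n σ τ ihσ ihτ =>
    rw [Approx] at h ⊢
    exact fun i hi a N hN => ihτ i hi (h i hi a N hN) hM.app
  | mu n τ ih =>
    cases n with
    | zero => rw [Approx]; trivial
    | succ n =>
      rw [Approx] at h ⊢
      exact ih n (Nat.lt_succ_self n) h hM.unfold

namespace Tree

variable {A : Tree}

theorem result_res {n i : ℕ} {x : (lift A).obj (n + 1)} {a : A.obj i}
    (h : result n ((lift A).res n x) = some ⟨i, a⟩) :
    ∃ a', result (n + 1) x = some ⟨i + 1, a'⟩ ∧ A.res i a' = a := by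
  induction n with
  | zero =>
    obtain b | r := x
    · cases h
      exact ⟨b, rfl, rfl⟩
    · cases h
  | succ n ih =>
    obtain b | r := x
    · cases h
      exact ⟨b, rfl, rfl⟩
    · exact ih (x := r) h

theorem result_le {n i : ℕ} {x : (lift A).obj n} {a : A.obj i}
    (h : result n x = some ⟨i, a⟩) : i ≤ n := by
  induction n with
  | zero =>
    obtain b | r := x
    · cases h; rfl
    · cases h
  | succ n ih =>
    obtain b | r := x
    · cases h; rfl
    · exact (ih (x := r) h).trans (Nat.le_succ n)

/-- Restriction in `▷ (A → B)` to a successor stage, evaluated at the last available stage. -/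
theorem later_exp_resLE {A B : Tree} {j k : ℕ} (h : j + 1 ≤ k + 1)
    (f : (later (exp A B)).obj (k + 1)) (a : A.obj j) :
    ((later (exp A B)).resLE h f : (exp A B).obj j).1 j le_rfl a =
      (f : (exp A B).obj k).1 j (Nat.le_of_succ_le_succ h) a := by
  have h' := Nat.le_of_succ_le_succ h
  induction k, h' using Nat.le_induction with
  | base => rw [resLE_self]
  | succ k h' ih =>
    rw [← resLE_res _ (Nat.succ_le_succ h')]
    exact ih _ _

end Tree

/-- The logical relation is preserved by restriction to the previous stage. -/
theorem Approx.res {n : ℕ} {τ : Ty 0} {x : (den τ).obj (n + 1)} {M : Tm}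
    (h : Approx (n + 1) τ x M) : Approx n τ ((den τ).res n x) M := by
  induction n, τ using stage_induction generalizing M with
  | one n =>
    rw [Approx] at h ⊢
    intro hx
    obtain ⟨⟨i, a⟩, ha⟩ := Option.isSome_iff_exists.1 hx
    obtain ⟨a', ha', -⟩ := result_res ha
    exact h (by rw [ha']; rfl)
  | sum n σ τ ihσ ihτ =>
    rw [Approx] at h ⊢
    intro i hi
    refine ⟨fun a ha => ?_, fun b hb => ?_⟩
    · obtain ⟨a' | b', ha', hr⟩ := result_res ha
      · cases hr
        obtain ⟨L, hL, h'⟩ := (h _ (Nat.succ_le_succ hi)).1 _ ha'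
        exact ⟨L, hL, ihσ i hi h'⟩
      · cases hr
    · obtain ⟨a' | b', hb', hr⟩ := result_res hb
      · cases hr
      · cases hr
        obtain ⟨L, hL, h'⟩ := (h _ (Nat.succ_le_succ hi)).2 _ hb'
        exact ⟨L, hL, ihτ i hi h'⟩
  | prod n σ τ ihσ ihτ =>
    rw [Approx] at h ⊢
    exact ⟨ihσ h.1, ihτ h.2⟩
  | arr n σ τ ihσ ihτ =>
    rw [Approx] at h ⊢
    exact fun i hi a N hN => h i (Nat.le_succ_of_le hi) a N hN
  | mu n τ ih =>
    cases n with
    | zero => rw [Approx]; trivial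
    | succ n =>
      rw [Approx] at h ⊢
      have h' := ih n (Nat.lt_succ_self n) h
      exact (unroll τ).nat (n + 1) x ▸ h'

theorem Approx.resLE {n i : ℕ} (hi : i ≤ n) {τ : Ty 0} {x : (den τ).obj n} {M : Tm}
    (h : Approx n τ x M) : Approx i τ ((den τ).resLE hi x) M := by
  induction n, hi using Nat.le_induction with
  | base => rwa [resLE_self]
  | succ n hi ih =>
    rw [← resLE_res _ hi]
    exact ih h.res

/-- The relation `▷ Approx`. -/
def LaterApprox : (n : ℕ) → (τ : Ty 0) → (later (den τ)).obj n → Tm → Prop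
  | 0, _, _, _ => True
  | n + 1, τ, x, M => Approx n τ x M

/-- The maps `θ` preserve the logical relation; the term does not change, as steps are not
recorded. -/
theorem Approx.tick {n : ℕ} {τ : Ty 0} {x : (later (den τ)).obj n} {M : Tm}
    (h : LaterApprox n τ x M) : Approx n τ ((tick τ).app n x) M := by
  induction n, τ using stage_induction generalizing M with
  | one n =>
    rw [Approx, tick_one]
    cases n with
    | zero => exact fun hx => nomatch hx
    | succ n =>
      rw [LaterApprox, Approx] at h
      exact h
  | sum n σ τ ihσ ihτ =>
    rw [Approx, tick_sum]
    cases n with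
    | zero => exact fun i hi => ⟨fun a ha => (nomatch ha), fun b hb => (nomatch hb)⟩
    | succ n =>
      rw [LaterApprox, Approx] at h
      exact fun i _ => ⟨fun a ha => (h i (result_le (x := (x : (lift _).obj n)) ha)).1 a ha,
        fun b hb => (h i (result_le (x := (x : (lift _).obj n)) hb)).2 b hb⟩
  | prod n σ τ ihσ ihτ =>
    rw [Approx, tick_prod]
    cases n with
    | zero => exact ⟨ihσ trivial, ihτ trivial⟩
    | succ n =>
      rw [LaterApprox, Approx] at h
      exact ⟨ihσ h.1, ihτ h.2⟩
  | arr n σ τ ihσ ihτ =>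
    rw [Approx, tick_arr]
    intro i hi a N hN
    refine ihτ i hi ?_
    cases i with
    | zero => trivial
    | succ j =>
      cases n with
      | zero => exact absurd hi (Nat.not_succ_le_zero j)
      | succ k =>
        rw [LaterApprox, Approx] at h
        have h' := h j (Nat.le_of_succ_le_succ hi) _ N hN.res
        rw [← later_exp_resLE hi x] at h'
        exact h'
  | mu n τ ih =>
    cases n with
    | zero => rw [Approx]; trivial
    | succ k =>
      rw [Approx]
      have e : (unroll τ).app (k + 1) ((Ty.tick (.mu τ)).app (k + 1) x) =
          (Ty.tick (Ty.unfold τ)).app k ((unroll τ).app k x) := by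
        rw [tick_mu]
        exact congrArg (fun g : Hom _ _ => g.app (k + 1)
          ((Ty.tick (Ty.unfold τ)).app k ((unroll τ).app k x))) (unroll_roll τ)
      rw [e]
      refine ih k (Nat.lt_succ_self k) ?_
      cases k with
      | zero => trivial
      | succ j =>
        rw [LaterApprox, Approx] at h
        exact h

end FPC

namespace FPC
open FPC.Tree FPC.Ty

/-- Case analysis respects the logical relation: once the denotation of the scrutinee returns a
value, the scrutinee evaluates to a matching injection. -/
theorem approx_case {C : Tree} {σ τ ρ : Ty 0} {L M N : Tm}
    (f : Hom (Tree.prod C (Tree.sum (den σ) (den τ))) (den ρ)) {n : ℕ} {c : C.obj n}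
    {x : (den (.sum σ τ)).obj n} (hx : Approx n (.sum σ τ) x L)
    (hl : ∀ i (h : i ≤ n) (a : (den σ).obj i) L', Approx i σ a L' →
      Approx i ρ (f.app i (C.resLE h c, Sum.inl a)) (M.inst L'))
    (hr : ∀ i (h : i ≤ n) (b : (den τ).obj i) L', Approx i τ b L' →
      Approx i ρ (f.app i (C.resLE h c, Sum.inr b)) (N.inst L')) :
    Approx n ρ ((extend (Ty.tick ρ) f).app n (c, x)) (.case L M N) := by
  rw [Approx] at hx
  have val : ∀ m (hm : m ≤ n) (a : (Tree.sum (den σ) (den τ)).obj m),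
      result (A := Tree.sum (den σ) (den τ)) n x = some ⟨m, a⟩ →
      Approx m ρ ((extend (Ty.tick ρ) f).app m (C.resLE hm c, Sum.inl a)) (.case L M N) := by
    intro m hm a hres
    have e : (extend (Ty.tick ρ) f).app m (C.resLE hm c, Sum.inl a) =
      f.app m (C.resLE hm c, a) := extend_inl _ _ _ _ _
    rw [e]
    obtain a | b := a
    · obtain ⟨L', hL, ha⟩ := (hx m hm).1 a hres
      exact (hl m hm a L' ha).mono (Tm.Refines.case_inl hL)
    · obtain ⟨L', hL, hb⟩ := (hx m hm).2 b hres
      exact (hr m hm b L' hb).mono (Tm.Refines.case_inr hL)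
  -- The recursion of `extend` runs through the stages `m ≤ n`, with what is left of `x` after
  -- `n - m` steps.
  have key : ∀ m (hm : m ≤ n) (y : (lift (Tree.sum (den σ) (den τ))).obj m),
      (∀ p, result m y = some p → result (A := Tree.sum (den σ) (den τ)) n x = some p) →
      Approx m ρ ((extend (Ty.tick ρ) f).app m (C.resLE hm c, y)) (.case L M N) := by
    intro m
    induction m with
    | zero =>
      rintro hm (a | r) hy
      · exact val 0 hm a (hy _ (result_inl 0 a))
      · exact Approx.tick (n := 0) (x := PUnit.unit) trivial
    | succ m ih =>
      rintro hm (a | r) hy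
      · exact val (m + 1) hm a (hy _ (result_inl _ a))
      · refine Approx.tick (n := m + 1) ?_
        have h := ih (Nat.le_of_succ_le hm) r hy
        rw [← res_resLE _ hm] at h
        exact h
  have h := key n le_rfl x fun _ h => h
  rwa [resLE_self] at h

/-- The fundamental lemma of the logical relation. -/
theorem approx_den {Γ : List (Ty 0)} {M : Tm} {τ : Ty 0} (d : HasType Γ M τ) :
    ∀ (n : ℕ) (γ : (denCtx Γ).obj n) (s : ℕ → Tm),
      (∀ i σ (x : Lookup Γ i σ), Approx n σ (x.den.app n γ) (s i)) →
      Approx n τ (d.den.app n γ) (M.subst s) := by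
  have cons : ∀ {Γ : List (Ty 0)} {n : ℕ} {γ : (denCtx Γ).obj n} {s : ℕ → Tm} {i : ℕ} (hi : i ≤ n)
      {σ : Ty 0} {a : (den σ).obj i} {N : Tm},
      (∀ i σ (x : Lookup Γ i σ), Approx n σ (x.den.app n γ) (s i)) → Approx i σ a N →
      ∀ j ρ (x : Lookup (σ :: Γ) j ρ),
        Approx i ρ (x.den.app i ((denCtx Γ).resLE hi γ, a)) (Tm.cons N s j) := by
    intro Γ n γ s i hi σ a N hs ha j ρ x
    cases x with
    | zero => exact ha
    | succ x =>
      have h := (hs _ _ x).resLE hi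
      rw [x.den.resLE] at h
      exact h
  induction d with
  | var x => exact fun n γ s hs => hs _ _ x
  | unit =>
    intro n γ s hs
    rw [Approx]
    exact fun _ => ⟨0, .value .unit⟩
  | lam d ih =>
    intro n γ s hs
    rw [Approx]
    intro i hi a N hN
    refine (ih i ((denCtx _).resLE hi γ, a) (Tm.cons N s) (cons hi hs hN)).mono ?_
    rw [← Tm.inst_subst]
    exact Tm.Refines.beta _
  | app d e ihd ihe =>
    intro n γ s hs
    have h := ihd n γ s hs
    rw [Approx] at h
    exact h n le_rfl _ _ (ihe n γ s hs)
  | @inl _ σ τ _ d ih =>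
    intro n γ s hs
    rw [Approx]
    intro i _
    have e : result (A := Tree.sum (den σ) (den τ)) n ((HasType.den (.inl (τ₂ := τ) d)).app n γ) =
      some ⟨n, Sum.inl (d.den.app n γ)⟩ := result_inl n _
    refine ⟨fun a ha => ?_, fun b hb => ?_⟩
    · cases e.symm.trans ha
      exact ⟨_, ⟨0, .value (.inl _)⟩, ih n γ s hs⟩
    · cases e.symm.trans hb
  | @inr _ σ τ _ d ih =>
    intro n γ s hs
    rw [Approx]
    intro i _
    have e : result (A := Tree.sum (den σ) (den τ)) n ((HasType.den (.inr (τ₁ := σ) d)).app n γ) =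
      some ⟨n, Sum.inr (d.den.app n γ)⟩ := result_inl n _
    refine ⟨fun a ha => ?_, fun b hb => ?_⟩
    · cases e.symm.trans ha
    · cases e.symm.trans hb
      exact ⟨_, ⟨0, .value (.inr _)⟩, ih n γ s hs⟩
  | case d e f ihd ihe ihf =>
    intro n γ s hs
    refine approx_case (caseHom e.den f.den) (ihd n γ s hs) (fun i hi a L' ha => ?_)
      (fun i hi b L' hb => ?_)
    · rw [Tm.inst_subst]
      exact ihe i _ _ (cons hi hs ha)
    · rw [Tm.inst_subst]
      exact ihf i _ _ (cons hi hs hb)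
  | fst d ih =>
    intro n γ s hs
    have h := ih n γ s hs
    rw [Approx] at h
    exact h.1
  | snd d ih =>
    intro n γ s hs
    have h := ih n γ s hs
    rw [Approx] at h
    exact h.2
  | pair d e ihd ihe =>
    intro n γ s hs
    rw [Approx]
    exact ⟨(ihd n γ s hs).mono Tm.Refines.fst_pair, (ihe n γ s hs).mono Tm.Refines.snd_pair⟩
  | @unfold _ τ _ d ih =>
    intro n γ s hs
    have h := ih n γ s hs
    refine Approx.tick ?_
    cases n with
    | zero => trivial
    | succ n =>
      rw [Approx] at h
      exact h
  | @fold _ τ _ d ih =>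
    intro n γ s hs
    have h := ih n γ s hs
    cases n with
    | zero => rw [Approx]; trivial
    | succ n =>
      rw [Approx]
      have e : (unroll τ).app (n + 1) ((HasType.den (.fold d)).app (n + 1) γ) =
          (den (Ty.unfold τ)).res n (d.den.app (n + 1) γ) :=
        congrArg (fun g : Hom _ _ => g.app (n + 1) ((Tree.next _).app (n + 1)
          (d.den.app (n + 1) γ))) (unroll_roll τ)
      rw [e]
      exact h.res.mono Tm.Refines.unfold_fold

/-- A closed term of unit type whose denotation terminates evaluates to the unit value. -/
theorem evalsTo_of_isSome_result {M : Tm} (d : HasType [] M .one) {n : ℕ}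
    (h : (result (A := Tree.one) n (d.den.app n PUnit.unit)).isSome) : EvalsTo M .unit := by
  have h' := approx_den d n PUnit.unit Tm.var (fun i σ x => nomatch x)
  rw [Tm.subst_var, Approx] at h'
  exact h' h

/-- The denotation of a closed term of unit type that evaluates to the unit value terminates. -/
theorem exists_isSome_result_of_evalsTo {M : Tm} (d : HasType [] M .one) (h : EvalsTo M .unit) :
    ∃ n, (result (A := Tree.one) n (d.den.app n PUnit.unit)).isSome := by
  obtain ⟨k, hk⟩ := h
  obtain ⟨d', hd⟩ := hk.den_eq d
  cases d'
  have h := hd k PUnit.unit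
  rw [delay_one] at h
  exact ⟨k, isSome_result rfl h⟩

/-! ### Closed terms of unit type -/

namespace Fam

variable {A B : Tree}

/-- The converse of a relation. -/
def converse (R : Rel A B) : Rel B A :=
  ⟨fun n p => R.obj n (p.2, p.1), fun n p p' h => R.res n _ _ (by subst h; rfl)⟩

/-- The converse of `L R` is contained in `L` of the converse of `R`. -/
def liftRelConverse (R : Rel A B) : ∀ n (x : (lift A).obj n) (y : (lift B).obj n),
    liftRelStep n (R.obj n) (liftRelTail R n) x y →
      liftRelStep n ((converse R).obj n) (liftRelTail (converse R) n) y x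
  | _, Sum.inl _, Sum.inl _, e => e
  | _, Sum.inl _, Sum.inr _, e => e
  | _, Sum.inr _, Sum.inl _, e => e
  | 0, Sum.inr _, Sum.inr _, _ => PUnit.unit
  | n + 1, Sum.inr x, Sum.inr y, e => liftRelConverse R n x y e

theorem liftRelConverse_res (R : Rel A B) (n : ℕ) (x : (lift A).obj (n + 1))
    (y : (lift B).obj (n + 1)) (e : liftRelStep (n + 1) (R.obj _) (liftRelTail R _) x y) :
    liftRelStepRes (fun p => (converse R).res n p _ rfl) (liftRelTailRes (converse R) n) y x
      (liftRelConverse R (n + 1) x y e) =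
    liftRelConverse R n ((lift A).res n x) ((lift B).res n y)
      (liftRelStepRes (fun p => R.res n p _ rfl) (liftRelTailRes R n) x y e) := by
  induction n with
  | zero => obtain a | x := x <;> obtain b | y := y <;> rfl
  | succ n ih =>
    obtain a | x := x <;> obtain b | y := y
    · rfl
    · rfl
    · rfl
    · exact ih x y e

/-- Morphisms into lifted objects that respect `L R` terminate together at a global element. -/
theorem exists_isSome_result_iff {R : Rel A B} {f : Hom one (lift A)} {g : Hom one (lift B)}
    {S : Rel one one} (s : ∀ n, S.obj n (PUnit.unit, PUnit.unit))
    (hs : ∀ n, S.res n _ _ rfl (s (n + 1)) = s n) (h : Respects S (liftRel R) f g) :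
    (∃ n, (result n (f.app n PUnit.unit)).isSome) ↔
      ∃ n, (result n (g.app n PUnit.unit)).isSome := by
  obtain ⟨φ, hφ⟩ := h
  have hf := fun n => f.nat n PUnit.unit
  have hg := fun n => g.nat n PUnit.unit
  have he : ∀ n, (liftRel R).res n _ (f.app n PUnit.unit, g.app n PUnit.unit)
      (Prod.ext (hf n) (hg n)) (φ (n + 1) (PUnit.unit, PUnit.unit) (s (n + 1))) =
      φ n (PUnit.unit, PUnit.unit) (s n) := fun n =>
    (hφ n (PUnit.unit, PUnit.unit) _ rfl _).trans (congrArg (φ n _) (hs n))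
  constructor
  · rintro ⟨k, hk⟩
    exact exists_isSome_result k (fun n => f.app n PUnit.unit) (fun n => g.app n PUnit.unit) hf hg
      (fun n => φ n _ (s n)) he hk
  · rintro ⟨k, hk⟩
    refine exists_isSome_result (R := converse R) k (fun n => g.app n PUnit.unit)
      (fun n => f.app n PUnit.unit) hg hf
      (fun n => liftRelConverse R n _ _ (φ n (PUnit.unit, PUnit.unit) (s n))) (fun n => ?_) hk
    rw [← he n]
    have key : ∀ x y (hx : (lift A).res n (f.app (n + 1) PUnit.unit) = x)
        (hy : (lift B).res n (g.app (n + 1) PUnit.unit) = y)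
        (e : (liftRel R).obj (n + 1) (f.app (n + 1) PUnit.unit, g.app (n + 1) PUnit.unit)),
        (liftRel (converse R)).res n (g.app (n + 1) PUnit.unit, f.app (n + 1) PUnit.unit) (y, x)
          (Prod.ext hy hx) (liftRelConverse R (n + 1) _ _ e) =
        liftRelConverse R n x y ((liftRel R).res n
          (f.app (n + 1) PUnit.unit, g.app (n + 1) PUnit.unit)
            (x, y) (Prod.ext hx hy) e) := by
      rintro x y rfl rfl e
      exact liftRelConverse_res R n _ _ e
    exact key _ _ (hf n) (hg n) _

end Fam

/-- Weakly bisimilar closed terms of unit type terminate together. -/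
theorem Bisimilar.evalsTo_iff {M N : Tm} {d : HasType [] M .one} {e : HasType [] N .one}
    (h : Bisimilar d e) : EvalsTo M .unit ↔ EvalsTo N .unit := by
  unfold Bisimilar at h
  rw [bisim_one] at h
  have key := Fam.exists_isSome_result_iff (S := Fam.eqRel Tree.one) (fun _ => ⟨rfl⟩)
    (fun _ => rfl) h
  exact ⟨fun hM => (key.1 (exists_isSome_result_of_evalsTo d hM)).elim fun _ hn =>
      evalsTo_of_isSome_result e hn,
    fun hN => (key.2 (exists_isSome_result_of_evalsTo e hN)).elim fun _ hn =>
      evalsTo_of_isSome_result d hn⟩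

end FPC

theorem mainTheorem2 (Γ : List (FPC.Ty 0)) (τ : FPC.Ty 0) (M N : FPC.Tm)
    (dM : FPC.HasType Γ M τ) (dN : FPC.HasType Γ N τ)
    (h : Nonempty (FPC.BisimGlobal Γ τ dM.denGlobal dN.denGlobal)) :
    FPC.CtxEquiv Γ τ M N := by
  intro C hC
  obtain ⟨_, _, hCM⟩ := (FPC.Bisimilar.of_global h).fill hC
  exact hCM.evalsTo_iff
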